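/- Let $n\ge 1$ and $f_a(z)=\sum_{i=0}^n z_i^{n+1}-a\prod_{i=0}^n z_i$ for $a\in\mathbb C$. Let $S\subseteq\mathbb C$ be the set of $a$ for which the hypersurface $Q_a=\{f_a=0\}\subset\mathbb P^n$ is nonsingular, and put $X=\mathbb C^{n+1}\times S$, $F(z,a)=f_a(z)$, $\Omega=dz_0\wedge\cdots\wedge dz_n$, $\theta_a=a\,\partial_a$. Write $\Omega^k_{X/S}$ for the space of holomorphic $k$-forms on $X$ relative to $S$ and $d$ for the relative exterior derivative. For $\omega\in\Omega^{n+1}_{X/S}$ let the geometric section $s[\omega]$ be its class in the Brieskorn lattice $\mathcal H^{(0)}=\Omega^{n+1}_{X/S}/dF\wedge d\Omega^{n-1}_{X/S}$, which maps to the Gauss--Manin system $$\mathcal H_X=\Omega^{n+1}_{X/S}[\partial_t]\,/\,(d-\partial_t\,dF\wedge)\,\Omega^{n}_{X/S}[\partial_t].$$ The ring $\mathcal D_S=\mathcal O(S)\langle\partial_a\rangle$ of linear differential operators on $S$ with holomorphic coefficients acts on $\mathcal H_X$, where $\partial_a(\omega\,\partial_t^k)=\frac{\partial\omega}{\partial a}\,\partial_t^k-\frac{\partial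 F}{\partial a}\,\omega\,\partial_t^{k+1}$. For $\mathbf m=(m_0,\dots,m_n)\in\mathbb Z_{\ge0}^{n+1}$ put $\mathbf z^{\mathbf m}=\prod_i z_i^{m_i}$ and $$L_{\mathbf m}=\prod_{i=0}^n(\theta_a+i-n)-\frac{a^{n+1}}{(n+1)^{n+1}}\prod_{i=0}^n(\theta_a+m_i+1)\in\mathcal D_S .$$ Then: 1. $S=\mathbb C\setminus\{a: a^{n+1}=(n+1)^{n+1}\}$. 2. For every $\mathbf m$, the operator $L_{\mathbf m}$ has order $n+1$, and $L_{\mathbf m}\,s[\mathbf z^{\mathbf m}\Omega]=0$ in $\mathcal H_X$. 3. $L_{\mathbf m}$ is unchanged when the entries of $\mathbf m$ are permuted. 4. Suppose $0\le m_i\le n-1$ for all $i$, and let $c$ be the number of distinct elements of the set $\{m_i+1: 0\le i\le n\}$. Among the left factors of $L_{\mathbf m}$ of the form $Q(\theta_a)$, that is, the polynomials $Q\in\mathbb C[x]$ with $L_{\mathbf m}=Q(\theta_a)R'$ for some $R'\in\mathcal D_S$, there is one, $P(\theta_a)$, such that every such $Q$ divides $P$. It has order $\deg P=c$, and there is $R\in\mathcal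 D_S$ of order $n+1-c$ with $L_{\mathbf m}=P(\theta_a)\,R$ such that $R\,s[\mathbf z^{\mathbf m'}\Omega]=0$ in $\mathcal H_X$ for every permutation $\mathbf m'$ of $\mathbf m$; in particular $R\,s[\mathbf z^{\mathbf m}\Omega]=0$. -/

import Mathlib

open TopologicalSpace

noncomputable section

namespace Dwork

/-! ### Holomorphic functions on an open set -/

section Hol

set_option linter.unusedSectionVars false

variable {E : Type*} [NormedAddCommGroup E] [NormedSpace ℂ E]

/-- Extension by zero of a function on an open set. Only its germs at points of `U` matter. -/
def extendZero {U : Opens E} (f : U → ℂ) : E → ℂ := Function.extend Subtype.val f 0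

theorem extendZero_coe {U : Opens E} (f : U → ℂ) (x : U) : extendZero f x = f x :=
  Subtype.val_injective.extend_apply f 0 x

theorem extendZero_eventuallyEq {U : Opens E} {f : U → ℂ} {g : E → ℂ}
    (h : ∀ x : U, f x = g x) {x : E} (hx : x ∈ U) : extendZero f =ᶠ[nhds x] g := by
  filter_upwards [U.isOpen.mem_nhds hx] with y hy
  rw [show y = ((⟨y, hy⟩ : U) : E) from rfl, extendZero_coe, h]

/-- The algebra of holomorphic functions on the open set `U`, inside all functions on `U`. -/
def holSubalgebra (U : Opens E) : Subalgebra ℂ (U → ℂ) where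
  carrier := {f | AnalyticOnNhd ℂ (extendZero f) U}
  mul_mem' := by
    intro f g hf hg x hx
    refine ((hf x hx).mul (hg x hx)).congr (extendZero_eventuallyEq (fun y => ?_) hx).symm
    simp [extendZero_coe]
  add_mem' := by
    intro f g hf hg x hx
    refine ((hf x hx).add (hg x hx)).congr (extendZero_eventuallyEq (fun y => ?_) hx).symm
    simp [extendZero_coe]
  algebraMap_mem' := by
    intro c x hx
    exact (analyticAt_const (v := c)).congr (extendZero_eventuallyEq (fun y => rfl) hx).symm

/-- The `ℂ`-algebra `𝓞(U)` of holomorphic functions on the open set `U`. -/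
def Hol (U : Opens E) : Type _ := holSubalgebra U

instance (U : Opens E) : CommRing (Hol U) := inferInstanceAs (CommRing (holSubalgebra U))

instance (U : Opens E) : Algebra ℂ (Hol U) := inferInstanceAs (Algebra ℂ (holSubalgebra U))

/-- The underlying function on `U`. -/
def Hol.val {U : Opens E} (f : Hol U) : U → ℂ := Subtype.val (p := (· ∈ holSubalgebra U)) f

/-- A function on `U` that is the restriction of a function analytic on `U`. -/
def Hol.of {U : Opens E} (f : U → ℂ) (g : E → ℂ)
    (hg : AnalyticOnNhd ℂ g U) (h : ∀ x : U, f x = g x) : Hol U :=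
  (⟨f, fun x hx => (hg x hx).congr (extendZero_eventuallyEq h hx).symm⟩ : holSubalgebra U)

@[ext]
theorem Hol.ext {U : Opens E} {f g : Hol U} (h : ∀ x, f.val x = g.val x) : f = g :=
  Subtype.ext (funext h)

theorem Hol.val_of {U : Opens E} (f : U → ℂ) (g : E → ℂ)
    (hg : AnalyticOnNhd ℂ g U) (h : ∀ x : U, f x = g x) (x : U) :
    (Hol.of f g hg h).val x = f x := rfl

theorem Hol.val_add {U : Opens E} (f g : Hol U) (x : U) :
    (f + g).val x = f.val x + g.val x := rfl

theorem Hol.val_mul {U : Opens E} (f g : Hol U) (x : U) :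
    (f * g).val x = f.val x * g.val x := rfl

theorem Hol.val_smul {U : Opens E} (c : ℂ) (f : Hol U) (x : U) :
    (c • f).val x = c * f.val x := rfl

theorem Hol.val_zero {U : Opens E} (x : U) : (0 : Hol U).val x = 0 := rfl

theorem Hol.analytic {U : Opens E} (f : Hol U) : AnalyticOnNhd ℂ (extendZero f.val) U :=
  Subtype.prop (p := (· ∈ holSubalgebra U)) f

theorem Hol.differentiableAt {U : Opens E} (f : Hol U) (x : U) :
    DifferentiableAt ℂ (extendZero f.val) x := (f.analytic x x.2).differentiableAt

/-- The derivative `∂_v f` of a holomorphic function in the direction `v`. -/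
def Hol.pd {U : Opens E} (v : E) : Derivation ℂ (Hol U) (Hol U) :=
  Derivation.mk'
    { toFun := fun f => Hol.of (fun x => fderiv ℂ (extendZero f.val) x v)
        (fun x => fderiv ℂ (extendZero f.val) x v)
        (fun x hx => ((ContinuousLinearMap.apply ℂ ℂ v).analyticAt _).comp
          (f.analytic.fderiv_of_isOpen U.isOpen x hx)) (fun _ => rfl)
      map_add' := by
        intro f g
        ext x
        have h : extendZero (f + g).val =ᶠ[nhds (x : E)] extendZero f.val + extendZero g.val :=
          extendZero_eventuallyEq (fun y => by simp [extendZero_coe, Hol.val_add]) x.2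
        change fderiv ℂ (extendZero (f + g).val) x v =
          fderiv ℂ (extendZero f.val) x v + fderiv ℂ (extendZero g.val) x v
        rw [h.fderiv_eq, fderiv_add (f.differentiableAt x) (g.differentiableAt x)]
        rfl
      map_smul' := by
        intro c f
        ext x
        have h : extendZero (c • f).val =ᶠ[nhds (x : E)] c • extendZero f.val :=
          extendZero_eventuallyEq (fun y => by simp [extendZero_coe, Hol.val_smul]) x.2
        change fderiv ℂ (extendZero (c • f).val) x v = c * fderiv ℂ (extendZero f.val) x v
        rw [h.fderiv_eq, fderiv_const_smul (f.differentiableAt x)]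
        rfl }
    (by
      intro f g
      ext x
      have h : extendZero (f * g).val =ᶠ[nhds (x : E)] extendZero f.val * extendZero g.val :=
        extendZero_eventuallyEq (fun y => by simp [extendZero_coe, Hol.val_mul]) x.2
      change fderiv ℂ (extendZero (f * g).val) x v =
        f.val x * fderiv ℂ (extendZero g.val) x v + g.val x * fderiv ℂ (extendZero f.val) x v
      rw [h.fderiv_eq, fderiv_mul (f.differentiableAt x) (g.differentiableAt x)]
      simp [extendZero_coe])

theorem Hol.pd_apply {U : Opens E} (v : E) (f : Hol U) (x : U) :
    (Hol.pd v f).val x = fderiv ℂ (extendZero f.val) x v := rfl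

theorem Hol.pd_eq {U : Opens E} (v : E) (f : Hol U) (g : E → ℂ) (h : ∀ x : U, f.val x = g x)
    (x : U) : (Hol.pd v f).val x = fderiv ℂ g x v := by
  rw [Hol.pd_apply, (extendZero_eventuallyEq h x.2).fderiv_eq]

theorem Hol.pd_comm {U : Opens E} (v w : E) (f : Hol U) :
    Hol.pd v (Hol.pd w f) = Hol.pd w (Hol.pd v f) := by
  ext x
  have hd : DifferentiableAt ℂ (fderiv ℂ (extendZero f.val)) x :=
    (f.analytic.fderiv_of_isOpen U.isOpen x x.2).differentiableAt
  have key : ∀ v w : E, (Hol.pd v (Hol.pd w f)).val x =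
      fderiv ℂ (fderiv ℂ (extendZero f.val)) x v w := by
    intro v w
    rw [Hol.pd_eq v (Hol.pd w f) (fun y => fderiv ℂ (extendZero f.val) y w) (fun _ => rfl),
      fderiv_clm_apply hd (differentiableAt_const w)]
    simp
  rw [key, key]
  exact (f.analytic x x.2).contDiffAt.isSymmSndFDerivAt_of_omega v w

end Hol

/-! ### The Dwork family, its discriminant and the base `S` -/

/-- `f_a = ∑ z_i^(n+1) - a ∏ z_i`. -/
def dworkPoly (n : ℕ) (a : ℂ) : MvPolynomial (Fin (n + 1)) ℂ :=
  ∑ i, MvPolynomial.X i ^ (n + 1) - MvPolynomial.C a * ∏ i, MvPolynomial.X i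

/-- The singular points of the hypersurface `Q_a = {f_a = 0}` in `ℙ^n`. -/
def singularPoints (n : ℕ) (a : ℂ) : Set (Projectivization ℂ (Fin (n + 1) → ℂ)) :=
  {p | MvPolynomial.eval p.rep (dworkPoly n a) = 0 ∧
    ∀ i, MvPolynomial.eval p.rep (MvPolynomial.pderiv i (dworkPoly n a)) = 0}

/-- The discriminant locus: the parameters for which `Q_a` is singular. -/
def discriminant (n : ℕ) : Set ℂ := {a | (singularPoints n a).Nonempty}

theorem eval_dworkPoly (n : ℕ) (a : ℂ) (z : Fin (n + 1) → ℂ) :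
    MvPolynomial.eval z (dworkPoly n a) = ∑ i, z i ^ (n + 1) - a * ∏ i, z i := by
  simp [dworkPoly]

theorem eval_pderiv_dworkPoly (n : ℕ) (a : ℂ) (i : Fin (n + 1)) (z : Fin (n + 1) → ℂ) :
    MvPolynomial.eval z (MvPolynomial.pderiv i (dworkPoly n a)) =
      (n + 1) * z i ^ n - a * ∏ j ∈ Finset.univ.erase i, z j := by
  have h1 : MvPolynomial.pderiv i (∑ j : Fin (n + 1), (MvPolynomial.X j ^ (n + 1) :
      MvPolynomial (Fin (n + 1)) ℂ)) =
      MvPolynomial.C ((n : ℂ) + 1) * MvPolynomial.X i ^ n := by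
    rw [map_sum, Finset.sum_eq_single i]
    · simp
    · intro j _ hj
      simp [MvPolynomial.pderiv_X_of_ne hj]
    · simp
  have h2 : MvPolynomial.pderiv i (∏ j : Fin (n + 1), (MvPolynomial.X j :
      MvPolynomial (Fin (n + 1)) ℂ)) = ∏ j ∈ Finset.univ.erase i, MvPolynomial.X j := by
    have h0 : ∀ s : Finset (Fin (n + 1)), i ∉ s → MvPolynomial.pderiv i (∏ j ∈ s,
        (MvPolynomial.X j : MvPolynomial (Fin (n + 1)) ℂ)) = 0 := by
      intro s
      induction s using Finset.induction_on with
      | empty => simp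
      | insert j s hj ih =>
        intro hi
        rw [Finset.mem_insert, not_or] at hi
        rw [Finset.prod_insert hj, Derivation.leibniz, ih hi.2,
          MvPolynomial.pderiv_X_of_ne (Ne.symm hi.1)]
        simp
    rw [← Finset.mul_prod_erase _ _ (Finset.mem_univ i), Derivation.leibniz,
      h0 _ (Finset.notMem_erase i _)]
    simp
  rw [dworkPoly, map_sub, h1, MvPolynomial.pderiv_C_mul, h2]
  simp

theorem mem_discriminant_iff (n : ℕ) (a : ℂ) : a ∈ discriminant n ↔
    ∃ z : Fin (n + 1) → ℂ, z ∈ Metric.sphere (0 : Fin (n + 1) → ℂ) 1 ∧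
      MvPolynomial.eval z (dworkPoly n a) = 0 ∧
      ∀ i, MvPolynomial.eval z (MvPolynomial.pderiv i (dworkPoly n a)) = 0 := by
  have hs : ∀ (c : ℂ) (z : Fin (n + 1) → ℂ), MvPolynomial.eval (c • z) (dworkPoly n a) =
      c ^ (n + 1) * MvPolynomial.eval z (dworkPoly n a) := by
    intro c z
    rw [eval_dworkPoly, eval_dworkPoly]
    simp only [Pi.smul_apply, smul_eq_mul, mul_pow, Finset.prod_mul_distrib,
      ← Finset.mul_sum, Finset.prod_const, Finset.card_univ, Fintype.card_fin]
    ring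
  have hd : ∀ (c : ℂ) (z : Fin (n + 1) → ℂ) (i : Fin (n + 1)),
      MvPolynomial.eval (c • z) (MvPolynomial.pderiv i (dworkPoly n a)) =
      c ^ n * MvPolynomial.eval z (MvPolynomial.pderiv i (dworkPoly n a)) := by
    intro c z i
    rw [eval_pderiv_dworkPoly, eval_pderiv_dworkPoly]
    simp only [Pi.smul_apply, smul_eq_mul, mul_pow, Finset.prod_mul_distrib,
      Finset.prod_const, Finset.card_erase_of_mem (Finset.mem_univ i), Finset.card_univ,
      Fintype.card_fin, Nat.add_sub_cancel]
    ring
  constructor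
  · rintro ⟨p, hp, hp'⟩
    have hn : ‖p.rep‖ ≠ 0 := norm_ne_zero_iff.2 p.rep_nonzero
    refine ⟨((‖p.rep‖⁻¹ : ℝ) : ℂ) • p.rep, ?_, ?_, fun i => ?_⟩
    · rw [mem_sphere_zero_iff_norm, norm_smul, Complex.norm_real, norm_inv, norm_norm,
        inv_mul_cancel₀ hn]
    · rw [hs, hp, mul_zero]
    · rw [hd, hp', mul_zero]
  · rintro ⟨z, hz, h, h'⟩
    have hz0 : z ≠ 0 := by
      rintro rfl
      simp at hz
    obtain ⟨c, hc⟩ := Projectivization.exists_smul_eq_mk_rep ℂ z hz0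
    refine ⟨Projectivization.mk ℂ z hz0, ?_, fun i => ?_⟩
    · rw [← hc, Units.smul_def, hs, h, mul_zero]
    · rw [← hc, Units.smul_def, hd, h', mul_zero]

theorem isClosed_discriminant (n : ℕ) : IsClosed (discriminant n) := by
  have hc : IsCompact (Metric.sphere (0 : Fin (n + 1) → ℂ) 1) := isCompact_sphere _ _
  have : CompactSpace (Metric.sphere (0 : Fin (n + 1) → ℂ) 1) :=
    isCompact_iff_compactSpace.1 hc
  let T : Set (Metric.sphere (0 : Fin (n + 1) → ℂ) 1 × ℂ) :=
    {p | (∑ i, p.1.1 i ^ (n + 1) - p.2 * ∏ i, p.1.1 i = 0) ∧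
      ∀ i, ((n : ℂ) + 1) * p.1.1 i ^ n - p.2 * ∏ j ∈ Finset.univ.erase i, p.1.1 j = 0}
  have hT : IsClosed T := by
    have hz : ∀ i, Continuous fun p : Metric.sphere (0 : Fin (n + 1) → ℂ) 1 × ℂ => p.1.1 i :=
      fun i => (continuous_apply i).comp (continuous_subtype_val.comp continuous_fst)
    have h2 : IsClosed (⋂ i : Fin (n + 1), {p : Metric.sphere (0 : Fin (n + 1) → ℂ) 1 × ℂ |
        ((n : ℂ) + 1) * p.1.1 i ^ n - p.2 * ∏ j ∈ Finset.univ.erase i, p.1.1 j = 0}) :=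
      isClosed_iInter fun i => isClosed_eq ((continuous_const.mul ((hz i).pow n)).sub
        (continuous_snd.mul (continuous_finsetProd _ fun j _ => hz j))) continuous_const
    have h1 : IsClosed {p : Metric.sphere (0 : Fin (n + 1) → ℂ) 1 × ℂ |
        ∑ i, p.1.1 i ^ (n + 1) - p.2 * ∏ i, p.1.1 i = 0} :=
      isClosed_eq ((continuous_finsetSum _ fun i _ => (hz i).pow _).sub
        (continuous_snd.mul (continuous_finsetProd _ fun j _ => hz j))) continuous_const
    convert h1.inter h2 using 1
    ext p
    simp [T]
  have : discriminant n = Prod.snd '' T := by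
    ext a
    rw [mem_discriminant_iff]
    simp only [eval_dworkPoly, eval_pderiv_dworkPoly]
    constructor
    · rintro ⟨z, hz, h⟩
      exact ⟨(⟨z, hz⟩, a), h, rfl⟩
    · rintro ⟨⟨z, a⟩, h, rfl⟩
      exact ⟨z.1, z.2, h⟩
  rw [this]
  exact isClosedMap_snd_of_compactSpace _ hT

/-- The base `S = ℂ ∖ Δ` of the family. -/
def S (n : ℕ) : Opens ℂ := ⟨(discriminant n)ᶜ, (isClosed_discriminant n).isOpen_compl⟩

/-- The total space `X = ℂ^(n+1) × S`. -/
def X (n : ℕ) : Opens ((Fin (n + 1) → ℂ) × ℂ) :=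
  ⟨Prod.snd ⁻¹' (S n : Set ℂ), (S n).isOpen.preimage continuous_snd⟩

/-- Holomorphic functions on `S`. -/
abbrev OS (n : ℕ) := Hol (S n)

/-- Holomorphic functions on `X`. -/
abbrev OX (n : ℕ) := Hol (X n)

/-- The derivation `d/da` of `𝓞(S)`. -/
def ddaS (n : ℕ) : Derivation ℂ (OS n) (OS n) := Hol.pd 1

/-- The derivation `∂/∂z_i` of `𝓞(X)`. -/
def ddz (n : ℕ) (i : Fin (n + 1)) : Derivation ℂ (OX n) (OX n) := Hol.pd (Pi.single i 1, 0)

/-- The derivation `∂/∂a` of `𝓞(X)`. -/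
def dda (n : ℕ) : Derivation ℂ (OX n) (OX n) := Hol.pd (0, 1)

/-- Pull-back of functions along the projection `X → S`. -/
def pull (n : ℕ) : OS n →ₐ[ℂ] OX n where
  toFun c := Hol.of (fun p => c.val ⟨p.1.2, p.2⟩) (fun p => extendZero c.val p.2)
    (fun p hp => (c.analytic p.2 hp).comp analyticAt_snd)
    (fun p => (extendZero_coe c.val ⟨p.1.2, p.2⟩).symm)
  map_one' := rfl
  map_mul' _ _ := rfl
  map_zero' := rfl
  map_add' _ _ := rfl
  commutes' _ := rfl

theorem pd_pull (n : ℕ) (v : (Fin (n + 1) → ℂ) × ℂ) (c : OS n) (p : X n) :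
    (Hol.pd v (pull n c)).val p = fderiv ℂ (extendZero c.val) p.1.2 v.2 := by
  have hc : DifferentiableAt ℂ (extendZero c.val) p.1.2 := c.differentiableAt ⟨p.1.2, p.2⟩
  rw [Hol.pd_eq v (pull n c) (extendZero c.val ∘ Prod.snd)
    (fun q => (extendZero_coe c.val ⟨q.1.2, q.2⟩).symm),
    fderiv_comp _ hc differentiableAt_snd, fderiv_snd]
  rfl

theorem ddz_pull (n : ℕ) (i : Fin (n + 1)) (c : OS n) : ddz n i (pull n c) = 0 := by
  ext p
  simp [ddz, pd_pull, Hol.val_zero]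

theorem dda_pull (n : ℕ) (c : OS n) : dda n (pull n c) = pull n (ddaS n c) := by
  ext p
  rw [dda, pd_pull]
  rfl

theorem analyticAt_coord (n : ℕ) (i : Fin (n + 1)) (p : (Fin (n + 1) → ℂ) × ℂ) :
    AnalyticAt ℂ (fun p : (Fin (n + 1) → ℂ) × ℂ => p.1 i) p :=
  ((ContinuousLinearMap.proj (R := ℂ) (φ := fun _ : Fin (n + 1) => ℂ) i).comp
    (ContinuousLinearMap.fst ℂ _ ℂ)).analyticAt p

/-- The deformation `F(z, a) = f_a(z)` as a function on `X`. -/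
def F (n : ℕ) : OX n :=
  Hol.of (fun p => MvPolynomial.eval p.1.1 (dworkPoly n p.1.2))
    (fun p => ∑ i, p.1 i ^ (n + 1) - p.2 * ∏ i, p.1 i)
    (fun p _ => (Finset.analyticAt_fun_sum _ fun i _ => (analyticAt_coord n i p).pow _).sub
      (analyticAt_snd.mul (Finset.analyticAt_fun_prod _ fun i _ => analyticAt_coord n i p)))
    (fun _ => eval_dworkPoly _ _ _)

/-- The monomial `z^m` as a function on `X`. -/
def monomialX (n : ℕ) (m : Fin (n + 1) → ℕ) : OX n :=
  Hol.of (fun p => ∏ i, p.1.1 i ^ m i) (fun p => ∏ i, p.1 i ^ m i)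
    (fun p _ => Finset.analyticAt_fun_prod _ fun i _ => (analyticAt_coord n i p).pow _)
    (fun _ => rfl)

/-! ### Relative differential forms on `X` over `S`

The form `∑_I ω_I dz_I` is given by its coefficients `ω_I`, where `dz_I` is the wedge product of
the `dz_i`, `i ∈ I`, in increasing order. -/

/-- Relative holomorphic forms on `X` over `S`, of all degrees. -/
def Forms (n : ℕ) : Type := Finset (Fin (n + 1)) → OX n

instance (n : ℕ) : AddCommGroup (Forms n) :=
  inferInstanceAs (AddCommGroup (Finset (Fin (n + 1)) → OX n))

instance (n : ℕ) : Module (OX n) (Forms n) :=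
  inferInstanceAs (Module (OX n) (Finset (Fin (n + 1)) → OX n))

instance (n : ℕ) : Module ℂ (Forms n) :=
  inferInstanceAs (Module ℂ (Finset (Fin (n + 1)) → OX n))

instance (n : ℕ) : IsScalarTower ℂ (OX n) (Forms n) :=
  inferInstanceAs (IsScalarTower ℂ (OX n) (Finset (Fin (n + 1)) → OX n))

/-- The coefficient of `dz_I`. -/
def Forms.coeff {n : ℕ} (ω : Forms n) (I : Finset (Fin (n + 1))) : OX n := ω I

/-- The form with given coefficients. -/
def Forms.mk {n : ℕ} (c : Finset (Fin (n + 1)) → OX n) : Forms n := c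

theorem Forms.ext {n : ℕ} {ω η : Forms n} (h : ∀ I, ω.coeff I = η.coeff I) : ω = η := funext h

@[simp]
theorem Forms.coeff_mk {n : ℕ} (c : Finset (Fin (n + 1)) → OX n) (I : Finset (Fin (n + 1))) :
    (Forms.mk c).coeff I = c I := rfl

@[simp]
theorem Forms.coeff_zero {n : ℕ} (I : Finset (Fin (n + 1))) : (0 : Forms n).coeff I = 0 := rfl

@[simp]
theorem Forms.coeff_add {n : ℕ} (ω η : Forms n) (I : Finset (Fin (n + 1))) :
    (ω + η).coeff I = ω.coeff I + η.coeff I := rfl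

@[simp]
theorem Forms.coeff_neg {n : ℕ} (ω : Forms n) (I : Finset (Fin (n + 1))) :
    (-ω).coeff I = -ω.coeff I := rfl

@[simp]
theorem Forms.coeff_smul {n : ℕ} (g : OX n) (ω : Forms n) (I : Finset (Fin (n + 1))) :
    (g • ω).coeff I = g * ω.coeff I := rfl

@[simp]
theorem Forms.coeff_csmul {n : ℕ} (c : ℂ) (ω : Forms n) (I : Finset (Fin (n + 1))) :
    (c • ω).coeff I = c • ω.coeff I := rfl

/-- Relative forms of degree `k`. -/
def Omega (n k : ℕ) : Submodule ℂ (Forms n) where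
  carrier := {ω | ∀ I, I.card ≠ k → ω.coeff I = 0}
  zero_mem' _ _ := rfl
  add_mem' h h' I hI := by simp [h I hI, h' I hI]
  smul_mem' c ω h I hI := by simp [h I hI]

/-- The form `dz_i ∧ ω`. -/
def dzWedge (n : ℕ) (i : Fin (n + 1)) : Forms n →ₗ[OX n] Forms n where
  toFun ω := Forms.mk fun J =>
    if i ∈ J then (-1) ^ (J.filter (· < i)).card * ω.coeff (J.erase i) else 0
  map_add' ω η := by
    refine Forms.ext fun J => ?_
    by_cases h : i ∈ J <;> simp [h, mul_add]
  map_smul' c ω := by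
    refine Forms.ext fun J => ?_
    by_cases h : i ∈ J <;> simp [h, mul_left_comm]

/-- A derivation of `𝓞(X)` acting on the coefficients of a form. -/
def coeffwise (n : ℕ) (δ : Derivation ℂ (OX n) (OX n)) : Forms n →ₗ[ℂ] Forms n :=
  { toFun := fun ω => Forms.mk fun I => δ (ω.coeff I)
    map_add' := fun ω η => Forms.ext fun I => by simp
    map_smul' := fun c ω => Forms.ext fun I => by simp }

/-- Multiplication of forms by a function. -/
def mulForm (n : ℕ) (g : OX n) : Forms n →ₗ[ℂ] Forms n where
  toFun ω := g • ω
  map_add' := smul_add g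
  map_smul' c ω := Forms.ext fun I => by simp

/-- The relative exterior derivative `dω = ∑ dz_i ∧ ∂ω/∂z_i`. -/
def extD (n : ℕ) : Forms n →ₗ[ℂ] Forms n :=
  ∑ i, (dzWedge n i).restrictScalars ℂ ∘ₗ coeffwise n (ddz n i)

/-- The form `dg ∧ ω`, with `dg = ∑ (∂g/∂z_i) dz_i` the relative differential of a function. -/
def dWedge (n : ℕ) (g : OX n) : Forms n →ₗ[ℂ] Forms n :=
  ∑ i, (dzWedge n i).restrictScalars ℂ ∘ₗ mulForm n (ddz n i g)

theorem extD_apply (n : ℕ) (ω : Forms n) :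
    extD n ω = ∑ i, dzWedge n i (coeffwise n (ddz n i) ω) := by
  simp [extD]

theorem dWedge_apply (n : ℕ) (g : OX n) (ω : Forms n) :
    dWedge n g ω = ∑ i, ddz n i g • dzWedge n i ω := by
  simp [dWedge, mulForm]

theorem dzWedge_mem {n k : ℕ} (i : Fin (n + 1)) {ω : Forms n} (h : ω ∈ Omega n k) :
    dzWedge n i ω ∈ Omega n (k + 1) := by
  intro J hJ
  by_cases hi : i ∈ J
  · have : (J.erase i).card ≠ k := by
      rw [Finset.card_erase_of_mem hi]
      have := Finset.card_pos.2 ⟨i, hi⟩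
      omega
    simp [dzWedge, hi, h _ this]
  · simp [dzWedge, hi]

theorem coeffwise_mem {n k : ℕ} (δ : Derivation ℂ (OX n) (OX n)) {ω : Forms n}
    (h : ω ∈ Omega n k) : coeffwise n δ ω ∈ Omega n k := by
  intro J hJ
  simp [coeffwise, h J hJ]

theorem mulForm_mem {n k : ℕ} (g : OX n) {ω : Forms n}
    (h : ω ∈ Omega n k) : mulForm n g ω ∈ Omega n k := by
  intro J hJ
  simp [mulForm, h J hJ]

theorem extD_mem {n k : ℕ} {ω : Forms n} (h : ω ∈ Omega n k) : extD n ω ∈ Omega n (k + 1) := by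
  rw [extD_apply]
  exact Submodule.sum_mem _ fun i _ => dzWedge_mem i (coeffwise_mem _ h)

theorem dWedge_mem {n k : ℕ} (g : OX n) {ω : Forms n} (h : ω ∈ Omega n k) :
    dWedge n g ω ∈ Omega n (k + 1) := by
  rw [dWedge, LinearMap.sum_apply]
  exact Submodule.sum_mem _ fun i _ => dzWedge_mem i (mulForm_mem _ h)

theorem dzWedge_coeffwise (n : ℕ) (i : Fin (n + 1)) (δ : Derivation ℂ (OX n) (OX n))
    (ω : Forms n) : coeffwise n δ (dzWedge n i ω) = dzWedge n i (coeffwise n δ ω) := by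
  refine Forms.ext fun J => ?_
  by_cases h : i ∈ J
  · rcases neg_one_pow_eq_or (OX n) (J.filter (· < i)).card with h' | h' <;>
      simp [coeffwise, dzWedge, h, h']
  · simp [coeffwise, dzWedge, h]

theorem coeffwise_smul (n : ℕ) (δ : Derivation ℂ (OX n) (OX n)) (g : OX n) (ω : Forms n) :
    coeffwise n δ (g • ω) = δ g • ω + g • coeffwise n δ ω := by
  refine Forms.ext fun J => ?_
  simp [coeffwise, mul_comm, add_comm]

theorem coeffwise_comm (n : ℕ) (v w : (Fin (n + 1) → ℂ) × ℂ) (ω : Forms n) :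
    coeffwise n (Hol.pd v) (coeffwise n (Hol.pd w) ω) =
      coeffwise n (Hol.pd w) (coeffwise n (Hol.pd v) ω) := by
  refine Forms.ext fun J => ?_
  exact Hol.pd_comm v w (ω.coeff J)

theorem dzWedge_self (n : ℕ) (i : Fin (n + 1)) (ω : Forms n) :
    dzWedge n i (dzWedge n i ω) = 0 := by
  refine Forms.ext fun J => ?_
  simp [dzWedge]

theorem dzWedge_anticomm (n : ℕ) (i j : Fin (n + 1)) (ω : Forms n) :
    dzWedge n i (dzWedge n j ω) = -dzWedge n j (dzWedge n i ω) := by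
  have key : ∀ i j : Fin (n + 1), i < j → ∀ ω : Forms n,
      dzWedge n i (dzWedge n j ω) = -dzWedge n j (dzWedge n i ω) := by
    intro i j hij ω
    refine Forms.ext fun J => ?_
    by_cases hi : i ∈ J
    · by_cases hj : j ∈ J
      · have e1 : (J.erase i).filter (· < j) = (J.filter (· < j)).erase i := by
          ext x; simp; tauto
        have e2 : (J.erase j).filter (· < i) = J.filter (· < i) := by
          ext x
          simp only [Finset.mem_filter, Finset.mem_erase]
          constructor
          · rintro ⟨⟨_, h⟩, h'⟩
            exact ⟨h, h'⟩
          · rintro ⟨h, h'⟩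
            exact ⟨⟨(h'.trans hij).ne, h⟩, h'⟩
        have hm : i ∈ J.filter (· < j) := by simp [hi, hij]
        obtain ⟨c, hc⟩ : ∃ c, (J.filter (· < j)).card = c + 1 :=
          ⟨_, (Nat.succ_pred_eq_of_pos (Finset.card_pos.2 ⟨i, hm⟩)).symm⟩
        have e3 : ((J.filter (· < j)).erase i).card = c := by
          rw [Finset.card_erase_of_mem hm, hc]; rfl
        simp only [dzWedge, LinearMap.coe_mk, AddHom.coe_mk, hi, hj, Forms.coeff_neg, Forms.coeff_mk, if_true,
          Finset.mem_erase, ne_eq, hij.ne, hij.ne', not_false_eq_true, and_self, e1, e2, e3, hc,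
          Finset.erase_right_comm (a := j) (b := i)]
        ring
      · simp [dzWedge, hj]
    · simp [dzWedge, hi]
  rcases lt_trichotomy i j with h | rfl | h
  · exact key i j h ω
  · simp [dzWedge_self]
  · rw [key j i h, neg_neg]

/-- `dg ∧ dg ∧ ω = 0`. -/
theorem dWedge_dWedge (n : ℕ) (g : OX n) (ω : Forms n) : dWedge n g (dWedge n g ω) = 0 := by
  have h : dWedge n g (dWedge n g ω) = -dWedge n g (dWedge n g ω) := by
    simp only [dWedge_apply, map_sum, map_smul]
    conv_lhs => rw [Finset.sum_comm]
    rw [← Finset.sum_neg_distrib]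
    refine Finset.sum_congr rfl fun i _ => ?_
    rw [← Finset.sum_neg_distrib]
    refine Finset.sum_congr rfl fun j _ => ?_
    rw [dzWedge_anticomm, smul_neg, smul_neg, smul_comm]
  have h2 : (2 : ℂ) • dWedge n g (dWedge n g ω) = 0 := by
    rw [two_smul]
    nth_rewrite 1 [h]
    simp
  exact (smul_eq_zero.1 h2).resolve_left two_ne_zero

/-- `d(dg ∧ ω) = - dg ∧ dω`. -/
theorem extD_dWedge (n : ℕ) (g : OX n) (ω : Forms n) :
    extD n (dWedge n g ω) = -dWedge n g (extD n ω) := by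
  have h1 : extD n (dWedge n g ω) =
      (∑ i, ∑ j, ddz n i (ddz n j g) • dzWedge n i (dzWedge n j ω)) +
      ∑ i, ∑ j, ddz n j g • dzWedge n i (dzWedge n j (coeffwise n (ddz n i) ω)) := by
    simp only [extD_apply, dWedge_apply, map_sum, coeffwise_smul, dzWedge_coeffwise, map_add,
      map_smul, Finset.sum_add_distrib]
    congr 1 <;> exact Finset.sum_comm
  have h2 : (∑ i, ∑ j, ddz n i (ddz n j g) • dzWedge n i (dzWedge n j ω)) = 0 := by
    set A := ∑ i, ∑ j, ddz n i (ddz n j g) • dzWedge n i (dzWedge n j ω) with hA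
    have h : A = -A := by
      conv_lhs => rw [hA, Finset.sum_comm]
      rw [hA, ← Finset.sum_neg_distrib]
      refine Finset.sum_congr rfl fun i _ => ?_
      rw [← Finset.sum_neg_distrib]
      refine Finset.sum_congr rfl fun j _ => ?_
      rw [dzWedge_anticomm, smul_neg, ddz, ddz, Hol.pd_comm]
    have h2 : (2 : ℂ) • A = 0 := by
      rw [two_smul]
      nth_rewrite 1 [h]
      simp
    exact (smul_eq_zero.1 h2).resolve_left two_ne_zero
  rw [h1, h2, zero_add]
  simp only [extD_apply, dWedge_apply, map_sum]
  rw [← Finset.sum_neg_distrib]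
  refine Finset.sum_congr rfl fun i _ => ?_
  rw [← Finset.sum_neg_distrib]
  refine Finset.sum_congr rfl fun j _ => ?_
  rw [dzWedge_anticomm, smul_neg]

/-! ### The Gauss-Manin system and the Brieskorn lattice

Both are given by forms that are holomorphic on all of `X`. The differential `d - ∂_t dF ∧` is
chosen so that `∂_t s[dF ∧ η] = s[dη]`. -/

/-- `Ω^•_{X/S}[∂_t]`: the element `ω` stands for `∑_k ω_k ∂_t^k`. -/
abbrev FormsD (n : ℕ) := ℕ →₀ Forms n

/-- `Ω^k_{X/S}[∂_t]`. -/
def OmegaD (n k : ℕ) : Submodule ℂ (FormsD n) where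
  carrier := {ω | ∀ j, ω j ∈ Omega n k}
  zero_mem' _ := Submodule.zero_mem _
  add_mem' h h' j := Submodule.add_mem _ (h j) (h' j)
  smul_mem' c _ h j := Submodule.smul_mem _ c (h j)

/-- The `ℂ[∂_t]`-linear extension of a linear map on forms. -/
def extendD (n : ℕ) (φ : Forms n →ₗ[ℂ] Forms n) : FormsD n →ₗ[ℂ] FormsD n :=
  Finsupp.mapRange.linearMap φ

/-- Multiplication by `∂_t`. -/
def shiftD (n : ℕ) : FormsD n →ₗ[ℂ] FormsD n := Finsupp.lmapDomain _ ℂ (· + 1)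

/-- The differential `d - ∂_t dF ∧` of `Ω^•_{X/S}[∂_t]`. -/
def twistedD (n : ℕ) : FormsD n →ₗ[ℂ] FormsD n :=
  extendD n (extD n) - shiftD n ∘ₗ extendD n (dWedge n (F n))

/-- The action of `∂_a` on `Ω^•_{X/S}[∂_t]`:
`∂_a (ω ∂_t^k) = (∂ω/∂a) ∂_t^k - (∂F/∂a) ω ∂_t^(k+1)`. -/
def preConn (n : ℕ) : FormsD n →ₗ[ℂ] FormsD n :=
  extendD n (coeffwise n (dda n)) - shiftD n ∘ₗ extendD n (mulForm n (dda n (F n)))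

/-- The action of a function of `a` on `Ω^•_{X/S}[∂_t]`. -/
def preMul (n : ℕ) (c : OS n) : FormsD n →ₗ[ℂ] FormsD n := extendD n (mulForm n (pull n c))

theorem extendD_single (n : ℕ) (φ : Forms n →ₗ[ℂ] Forms n) (k : ℕ) (ω : Forms n) :
    extendD n φ (Finsupp.single k ω) = Finsupp.single k (φ ω) := by
  simp [extendD]

theorem shiftD_single (n k : ℕ) (ω : Forms n) :
    shiftD n (Finsupp.single k ω) = Finsupp.single (k + 1) ω := by
  simp [shiftD]

theorem extendD_mem {n k l : ℕ} {φ : Forms n →ₗ[ℂ] Forms n}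
    (hφ : ∀ ω ∈ Omega n k, φ ω ∈ Omega n l) {ω : FormsD n} (h : ω ∈ OmegaD n k) :
    extendD n φ ω ∈ OmegaD n l := by
  intro j
  simpa [extendD] using hφ _ (h j)

theorem shiftD_mem {n k : ℕ} {ω : FormsD n} (h : ω ∈ OmegaD n k) :
    shiftD n ω ∈ OmegaD n k := by
  intro j
  cases j with
  | zero =>
    have : shiftD n ω 0 = 0 :=
      Finsupp.mapDomain_of_notMem_range _ _ (by simp)
    rw [this]
    exact Submodule.zero_mem _
  | succ j =>
    have : shiftD n ω (j + 1) = ω j :=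
      Finsupp.mapDomain_apply (add_left_injective 1) ω j
    rw [this]
    exact h j

theorem preConn_mem {n k : ℕ} {ω : FormsD n} (h : ω ∈ OmegaD n k) :
    preConn n ω ∈ OmegaD n k :=
  Submodule.sub_mem _ (extendD_mem (fun _ => coeffwise_mem _) h)
    (shiftD_mem (extendD_mem (fun _ => mulForm_mem _) h))

theorem preMul_mem {n k : ℕ} (c : OS n) {ω : FormsD n} (h : ω ∈ OmegaD n k) :
    preMul n c ω ∈ OmegaD n k :=
  extendD_mem (fun _ => mulForm_mem _) h

theorem coeffwise_dda_extD (n : ℕ) (ω : Forms n) :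
    coeffwise n (dda n) (extD n ω) = extD n (coeffwise n (dda n) ω) := by
  simp only [extD_apply, map_sum, dzWedge_coeffwise]
  refine Finset.sum_congr rfl fun i _ => ?_
  rw [dda, ddz, coeffwise_comm]

theorem extD_smul (n : ℕ) (g : OX n) (ω : Forms n) :
    extD n (g • ω) = dWedge n g ω + g • extD n ω := by
  simp only [extD_apply, dWedge_apply, coeffwise_smul, map_add, map_smul,
    Finset.sum_add_distrib, Finset.smul_sum]

theorem dWedge_smul (n : ℕ) (g h : OX n) (ω : Forms n) :
    dWedge n g (h • ω) = h • dWedge n g ω := by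
  simp only [dWedge_apply, map_smul, Finset.smul_sum]
  exact Finset.sum_congr rfl fun i _ => smul_comm _ _ _

theorem coeffwise_dda_dWedge (n : ℕ) (g : OX n) (ω : Forms n) :
    coeffwise n (dda n) (dWedge n g ω) =
      dWedge n (dda n g) ω + dWedge n g (coeffwise n (dda n) ω) := by
  simp only [dWedge_apply, map_sum, coeffwise_smul, dzWedge_coeffwise, Finset.sum_add_distrib]
  congr 1
  refine Finset.sum_congr rfl fun i _ => ?_
  rw [dda, ddz, Hol.pd_comm]

theorem preConn_twistedD (n : ℕ) :
    preConn n ∘ₗ twistedD n = twistedD n ∘ₗ preConn n := by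
  refine Finsupp.lhom_ext fun k ω => ?_
  simp only [preConn, twistedD, LinearMap.comp_apply, LinearMap.sub_apply, map_sub,
    extendD_single, shiftD_single]
  simp only [mulForm, LinearMap.coe_mk, AddHom.coe_mk, coeffwise_dda_extD, extD_smul,
    coeffwise_dda_dWedge, dWedge_smul, Finsupp.single_add]
  abel

theorem preMul_twistedD (n : ℕ) (c : OS n) :
    preMul n c ∘ₗ twistedD n = twistedD n ∘ₗ preMul n c := by
  have h0 : ∀ ω, dWedge n (pull n c) ω = 0 := fun ω => by
    simp [dWedge_apply, ddz_pull]
  refine Finsupp.lhom_ext fun k ω => ?_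
  simp only [preMul, twistedD, LinearMap.comp_apply, LinearMap.sub_apply, map_sub,
    extendD_single, shiftD_single]
  simp only [mulForm, LinearMap.coe_mk, AddHom.coe_mk, extD_smul, dWedge_smul, h0, zero_add]

/-- The boundaries `(d - ∂_t dF ∧) Ω^n_{X/S}[∂_t]` in `Ω^(n+1)_{X/S}[∂_t]`. -/
def boundaries (n : ℕ) : Submodule ℂ (OmegaD n (n + 1)) :=
  ((OmegaD n n).map (twistedD n)).comap (OmegaD n (n + 1)).subtype

/-- The Gauss-Manin system
`Ω^(n+1)_{X/S}[∂_t] / (d - ∂_t dF ∧) Ω^n_{X/S}[∂_t]` of the family. -/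
abbrev GaussManin (n : ℕ) := OmegaD n (n + 1) ⧸ boundaries n

/-- The endomorphism of the Gauss-Manin system induced by an endomorphism of
`Ω^•_{X/S}[∂_t]` that preserves degrees and commutes with the differential. -/
def descend (n : ℕ) (φ : FormsD n →ₗ[ℂ] FormsD n)
    (hφ : ∀ k, ∀ ω ∈ OmegaD n k, φ ω ∈ OmegaD n k)
    (hc : φ ∘ₗ twistedD n = twistedD n ∘ₗ φ) : GaussManin n →ₗ[ℂ] GaussManin n :=
  Submodule.mapQ _ _ (φ.restrict (hφ (n + 1))) (by
    rintro ω ⟨η, hη, hηω⟩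
    exact ⟨φ η, hφ n η hη, by
      rw [← LinearMap.comp_apply, ← hc, LinearMap.comp_apply, hηω]
      rfl⟩)

/-- The action of `∂_a` on the Gauss-Manin system. -/
def conn (n : ℕ) : Module.End ℂ (GaussManin n) :=
  descend n (preConn n) (fun _ _ => preConn_mem) (preConn_twistedD n)

/-- The action of functions on `S` on the Gauss-Manin system. -/
def mulGM (n : ℕ) (c : OS n) : Module.End ℂ (GaussManin n) :=
  descend n (preMul n c) (fun _ _ => preMul_mem c) (preMul_twistedD n c)

/-- The elements of `dF ∧ dΩ^(n-1)_{X/S}` in `Ω^(n+1)_{X/S}`. -/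
def brieskornRel (n : ℕ) : Submodule ℂ (Omega n (n + 1)) :=
  ((Omega n (n - 1)).map (dWedge n (F n) ∘ₗ extD n)).comap (Omega n (n + 1)).subtype

/-- The Brieskorn lattice `𝓗⁽⁰⁾ = Ω^(n+1)_{X/S} / dF ∧ dΩ^(n-1)_{X/S}`. -/
abbrev Brieskorn (n : ℕ) := Omega n (n + 1) ⧸ brieskornRel n

theorem single_mem {n k : ℕ} (j : ℕ) {ω : Forms n} (h : ω ∈ Omega n k) :
    Finsupp.single j ω ∈ OmegaD n k := by
  intro i
  rw [Finsupp.single_apply]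
  split_ifs
  · exact h
  · exact Submodule.zero_mem _

theorem single_rel_mem {n : ℕ} {η : Forms n} (hη : η ∈ Omega n (n - 1)) :
    Finsupp.single 0 (dWedge n (F n) (extD n η)) ∈ (OmegaD n n).map (twistedD n) := by
  rcases Nat.eq_zero_or_pos n with rfl | hn
  · have h2 : dWedge 0 (F 0) (extD 0 η) ∈ Omega 0 2 := dWedge_mem _ (extD_mem hη)
    have h0 : dWedge 0 (F 0) (extD 0 η) = 0 := Forms.ext fun I => h2 I (by
      have := Finset.card_le_univ I
      simp only [Fintype.card_fin] at this
      omega)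
    rw [h0, Finsupp.single_zero]
    exact Submodule.zero_mem _
  · have h : -dWedge n (F n) η ∈ Omega n n := by
      have := dWedge_mem (F n) hη
      rw [Nat.sub_add_cancel hn] at this
      exact Submodule.neg_mem _ this
    refine ⟨Finsupp.single 0 (-dWedge n (F n) η), single_mem 0 h, ?_⟩
    rw [twistedD, LinearMap.sub_apply, LinearMap.comp_apply, extendD_single, extendD_single,
      map_neg, map_neg, dWedge_dWedge, extD_dWedge, neg_neg, neg_zero, Finsupp.single_zero,
      map_zero, sub_zero]

/-- The inclusion `Ω^(n+1)_{X/S} ⊆ Ω^(n+1)_{X/S}[∂_t]`. -/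
def inclD (n : ℕ) : Omega n (n + 1) →ₗ[ℂ] OmegaD n (n + 1) :=
  (Finsupp.lsingle 0 : Forms n →ₗ[ℂ] FormsD n).restrict fun _ => single_mem 0

/-- The natural map from the Brieskorn lattice to the Gauss-Manin system, induced by
`Ω^(n+1)_{X/S} ⊆ Ω^(n+1)_{X/S}[∂_t]`. -/
def brieskornToGM (n : ℕ) : Brieskorn n →ₗ[ℂ] GaussManin n :=
  Submodule.mapQ (brieskornRel n) (boundaries n) (inclD n) (by
    rintro ω ⟨η, hη, hηω⟩
    have h := single_rel_mem hη
    rw [show dWedge n (F n) (extD n η) = ω from hηω] at h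
    exact h)

/-- The form `z^m Ω`, where `Ω = dz_0 ∧ ⋯ ∧ dz_n`. -/
def monomialForm (n : ℕ) (m : Fin (n + 1) → ℕ) : Omega n (n + 1) :=
  ⟨Forms.mk fun I => if I = Finset.univ then monomialX n m else 0, fun I hI => if_neg (by
    rintro rfl
    simp at hI)⟩

/-- The geometric section `s[ω]` of the Brieskorn lattice. -/
def geomSection (n : ℕ) (ω : Omega n (n + 1)) : Brieskorn n := (brieskornRel n).mkQ ω

/-! ### Differential operators on `S` -/

/-- The relations between functions `f` (generators `some f`) and `∂_a` (generator `none`) in the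
ring of differential operators. -/
inductive DiffRel (n : ℕ) :
    FreeAlgebra ℂ (Option (OS n)) → FreeAlgebra ℂ (Option (OS n)) → Prop
  | add (f g : OS n) : DiffRel n (FreeAlgebra.ι ℂ (some (f + g)))
      (FreeAlgebra.ι ℂ (some f) + FreeAlgebra.ι ℂ (some g))
  | mul (f g : OS n) : DiffRel n (FreeAlgebra.ι ℂ (some (f * g)))
      (FreeAlgebra.ι ℂ (some f) * FreeAlgebra.ι ℂ (some g))
  | const (c : ℂ) : DiffRel n (FreeAlgebra.ι ℂ (some (algebraMap ℂ (OS n) c)))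
      (algebraMap ℂ (FreeAlgebra ℂ (Option (OS n))) c)
  | leibniz (f : OS n) : DiffRel n (FreeAlgebra.ι ℂ none * FreeAlgebra.ι ℂ (some f))
      (FreeAlgebra.ι ℂ (some f) * FreeAlgebra.ι ℂ none + FreeAlgebra.ι ℂ (some (ddaS n f)))

/-- The ring `𝓓_S = 𝓞(S)⟨∂_a⟩` of linear differential operators on `S`, generated by functions
and `∂_a` with the relations `∂_a f = f ∂_a + f'`. -/
abbrev DiffOp (n : ℕ) := RingQuot (DiffRel n)

/-- A function as a differential operator of order zero. -/
def DiffOp.fn {n : ℕ} (f : OS n) : DiffOp n :=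
  RingQuot.mkAlgHom ℂ (DiffRel n) (FreeAlgebra.ι ℂ (some f))

/-- The differential operator `∂_a`. -/
def DiffOp.del (n : ℕ) : DiffOp n :=
  RingQuot.mkAlgHom ℂ (DiffRel n) (FreeAlgebra.ι ℂ none)

/-- The coordinate function `a` on `S`. -/
def coordA (n : ℕ) : OS n :=
  Hol.of (fun a => a) (fun a => a) (fun _ _ => analyticAt_id) fun _ => rfl

/-- The operator `θ_a = a ∂_a`. -/
def DiffOp.theta (n : ℕ) : DiffOp n := DiffOp.fn (coordA n) * DiffOp.del n

/-- `L = ∑_{k ≤ r} c_k ∂_a^k` with `c_r ≠ 0`. -/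
def DiffOp.HasOrder {n : ℕ} (L : DiffOp n) (r : ℕ) : Prop :=
  ∃ c : ℕ → OS n, c r ≠ 0 ∧
    L = ∑ k ∈ Finset.range (r + 1), DiffOp.fn (c k) * DiffOp.del n ^ k

/-- The left `𝓓_S`-module structure of the Gauss-Manin system. -/
def gmAction (n : ℕ) : DiffOp n →ₐ[ℂ] Module.End ℂ (GaussManin n) :=
  RingQuot.liftAlgHom ℂ ⟨FreeAlgebra.lift ℂ (fun o => o.elim (conn n) (mulGM n)), by
    have hs := extendD_single n
    have hext : ∀ φ ψ : Module.End ℂ (GaussManin n),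
        (∀ x : OmegaD n (n + 1), φ ((boundaries n).mkQ x) = ψ ((boundaries n).mkQ x)) →
          φ = ψ := by
      intro φ ψ h
      refine LinearMap.ext fun x => ?_
      obtain ⟨y, rfl⟩ := (boundaries n).mkQ_surjective x
      exact h y
    intro x y hxy
    cases hxy with
    | add f g =>
      simp only [FreeAlgebra.lift_ι_apply, map_add, Option.elim]
      refine hext _ _ fun x => congrArg (boundaries n).mkQ (Subtype.ext ?_)
      have : preMul n (f + g) = preMul n f + preMul n g := by
        refine Finsupp.lhom_ext fun k ω => ?_
        simp [preMul, hs, mulForm, add_smul]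
      exact LinearMap.congr_fun this x.1
    | mul f g =>
      simp only [FreeAlgebra.lift_ι_apply, map_mul, Option.elim]
      refine hext _ _ fun x => congrArg (boundaries n).mkQ (Subtype.ext ?_)
      have : preMul n (f * g) = preMul n f ∘ₗ preMul n g := by
        refine Finsupp.lhom_ext fun k ω => ?_
        simp [preMul, hs, mulForm, mul_smul]
      exact LinearMap.congr_fun this x.1
    | const c =>
      simp only [FreeAlgebra.lift_ι_apply, AlgHom.commutes, Option.elim]
      refine hext _ _ fun x => congrArg (boundaries n).mkQ (Subtype.ext ?_)
      have : preMul n (algebraMap ℂ (OS n) c) = c • LinearMap.id := by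
        refine Finsupp.lhom_ext fun k ω => ?_
        simp [preMul, hs, mulForm]
      exact LinearMap.congr_fun this x.1
    | leibniz f =>
      simp only [FreeAlgebra.lift_ι_apply, map_mul, map_add, Option.elim]
      refine hext _ _ fun x => congrArg (boundaries n).mkQ (Subtype.ext ?_)
      have : preConn n ∘ₗ preMul n f =
          preMul n f ∘ₗ preConn n + preMul n (ddaS n f) := by
        refine Finsupp.lhom_ext fun k ω => ?_
        simp only [preConn, preMul, LinearMap.comp_apply, LinearMap.sub_apply,
          LinearMap.add_apply, map_sub, hs, shiftD_single]
        simp only [mulForm, LinearMap.coe_mk, AddHom.coe_mk, coeffwise_smul, dda_pull,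
          Finsupp.single_add, smul_comm (pull n f) (dda n (F n)) ω]
        abel
      exact LinearMap.congr_fun this x.1⟩

/-- The operator
`∏_{i=0}^n (θ_a + i - n) - a^(n+1)/(n+1)^(n+1) ∏_{i=0}^n (θ_a + m_i + 1)`. -/
def picardFuchs (n : ℕ) (m : Fin (n + 1) → ℕ) : DiffOp n :=
  Polynomial.aeval (DiffOp.theta n)
      (∏ i ∈ Finset.range (n + 1), (Polynomial.X + Polynomial.C ((i : ℂ) - n))) -
    DiffOp.fn ((((n : ℂ) + 1) ^ (n + 1))⁻¹ • coordA n ^ (n + 1)) *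
      Polynomial.aeval (DiffOp.theta n)
        (∏ i, (Polynomial.X + Polynomial.C ((m i : ℂ) + 1)))

end Dwork

end

noncomputable section

namespace Dwork

/-! ### The discriminant -/

/-! Write `[z^p ∂_t^k]` for the class of `z^p Ω ∂_t^k`, `e_i` for the unit vectors and `𝟙` for the
all-ones exponent. Everything in the Gauss-Manin system follows from `∂_a [z^p ∂_t^k] = [z^(p+𝟙)
∂_t^(k+1)]` and from the exactness of `d(z^p ι_i Ω)` up to `∂_t dF ∧`. The latter has two uses.
Applied to `p + e_i` it gives `(θ + p_i + 1)[z^p ∂_t^k] = (n+1)[z^(p+(n+1)e_i) ∂_t^(k+1)]`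
(`gmAction_theta_add_gmMonomial`). When `p_i = 0` it trades `(n+1) z_i^n` for `a ∏_{j≠i} z_j` at an
unchanged positive power of `∂_t` (`smul_gmMonomial_add_single`).

Hence `∏ (θ + m_i + 1)` sends `[z^m]` to `(n+1)^(n+1) [z^(m+(n+1)𝟙) ∂_t^(n+1)]`, while `∏_{l≤n} (θ -
l) = a^(n+1) ∂_a^(n+1)` sends it to `a^(n+1)` times the same class without the constant. This is the
annihilation by `L_m`. For the smaller operator choose a set `I` of indices on which `m` takes each
of its values once. On the way up from `z^m`, the exponent of `z_i` equals `n` after `n - m_i`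
steps; there the trade replaces an application of `θ - (n - m_i)`. Both sides then meet at
`z_i^(m_i)` for `i ∈ I` and `z_i^(m_i+n+1)` otherwise (`gmAction_rightFactor`). The skipped factors
form `P = ∏_{i∈I} (x - (n - m_i))`. Since `P(x + n + 1) = ∏_{i∈I} (x + m_i + 1)`, moving `P(θ)` past
`a^(n+1)` gives `L_m = P(θ) R`.

Maximality is tested on functions. In the Taylor expansion at `0`, `θ` is diagonal, and each weight
component of an operator acts on the powers `a^s` through a polynomial in `s`. So `L_m = Q(θ) R'`
forces `Q` to divide both `∏_{l≤n} (x - l)` and `∏_i (x - (n - m_i))` (`dvd_of_eq_aeval_theta_mul`),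
and the greatest common divisor of these two is `P` (`dvd_leftFactor`). -/

theorem mem_discriminant_iff_pow_eq (n : ℕ) (a : ℂ) :
    a ∈ discriminant n ↔ a ^ (n + 1) = ((n : ℂ) + 1) ^ (n + 1) := by
  have hn0 : (n : ℂ) + 1 ≠ 0 := Nat.cast_add_one_ne_zero n
  rw [mem_discriminant_iff]
  simp only [eval_dworkPoly, eval_pderiv_dworkPoly]
  constructor
  · rintro ⟨z, hz, -, h⟩
    -- Multiplying the `i`-th partial derivative by `z_i` makes the second term independent of `i`.
    -- So one vanishing coordinate forces all to vanish, and otherwise the product over `i` can be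
    -- cancelled.
    have hmul : ∀ i, ((n : ℂ) + 1) * z i ^ (n + 1) = a * ∏ j, z j := by
      intro i
      rw [← Finset.mul_prod_erase _ _ (Finset.mem_univ i)]
      linear_combination z i * h i
    have hprod : ∏ j, z j ≠ 0 := by
      intro h0
      have hz0 : z = 0 := by
        funext i
        have := hmul i
        rw [h0, mul_zero] at this
        exact pow_eq_zero_iff (Nat.succ_ne_zero n) |>.1 ((mul_eq_zero.1 this).resolve_left hn0)
      simp [hz0] at hz
    have hall : ∏ i, (((n : ℂ) + 1) * z i ^ (n + 1)) = ∏ _i : Fin (n + 1), (a * ∏ j, z j) :=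
      Finset.prod_congr rfl fun i _ => hmul i
    rw [Finset.prod_mul_distrib, Finset.prod_pow] at hall
    simp only [Finset.prod_const, Finset.card_univ, Fintype.card_fin, mul_pow] at hall
    exact (mul_right_cancel₀ (pow_ne_zero _ hprod) hall).symm
  · intro h
    have ha : a ≠ 0 := by
      rintro rfl
      rw [zero_pow (Nat.succ_ne_zero n)] at h
      exact pow_ne_zero _ hn0 h.symm
    set ζ : ℂ := ((n : ℂ) + 1) / a with hζ
    have hζ1 : ζ ^ (n + 1) = 1 := by
      rw [hζ, div_pow, h, div_self (pow_ne_zero _ hn0)]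
    have hζ0 : ζ ≠ 0 := div_ne_zero hn0 ha
    have haζ : a * ζ = (n : ℂ) + 1 := mul_div_cancel₀ _ ha
    -- The point `(ζ, 1, …, 1)`: all `(n+1)`-st powers are `1` and the product of the coordinates is
    -- `ζ`, with `a ζ = n + 1`.
    set z : Fin (n + 1) → ℂ := Function.update 1 0 ζ with hz
    have hzp : ∀ i, z i ^ (n + 1) = 1 := by
      intro i
      by_cases hi : i = 0
      · subst hi; simp [hz, hζ1]
      · simp [hz, hi]
    have hzprod : ∏ i, z i = ζ := by
      rw [hz, Finset.prod_update_of_mem (Finset.mem_univ _)]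
      simp
    have hnorm : ∀ i, ‖z i‖ = 1 := fun i =>
      Complex.norm_eq_one_of_pow_eq_one (hzp i) (Nat.succ_ne_zero n)
    refine ⟨z, ?_, ?_, fun i => ?_⟩
    -- The norm is the supremum norm, so coordinates of modulus one suffice.
    · rw [mem_sphere_zero_iff_norm]
      refine le_antisymm ((pi_norm_le_iff_of_nonneg zero_le_one).2 fun i => (hnorm i).le) ?_
      rw [← hnorm 0]
      exact norm_le_pi_norm z 0
    · rw [hzprod, haζ]
      simp [hzp]
    · have hzi : z i ≠ 0 := by
        intro h0
        have := hnorm i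
        simp [h0] at this
      have h1 := Finset.mul_prod_erase _ z (Finset.mem_univ i)
      rw [hzprod] at h1
      have h2 : z i * z i ^ n = 1 := by rw [← pow_succ', hzp]
      apply mul_left_cancel₀ hzi
      linear_combination ((n : ℂ) + 1) * h2 - a * h1 - haζ

theorem mem_S_iff (n : ℕ) (a : ℂ) : a ∈ S n ↔ a ^ (n + 1) ≠ ((n : ℂ) + 1) ^ (n + 1) :=
  not_congr (mem_discriminant_iff_pow_eq n a)

/-- Provides the base point for Taylor expansions. -/
theorem zero_mem_S (n : ℕ) : (0 : ℂ) ∈ S n := by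
  rw [mem_S_iff, zero_pow (Nat.succ_ne_zero n)]
  exact (pow_ne_zero _ (Nat.cast_add_one_ne_zero n)).symm

theorem one_lt_cast_add_one_pow {n : ℕ} (hn : 1 ≤ n) : (1 : ℝ) < ((n : ℝ) + 1) ^ (n + 1) :=
  one_lt_pow₀ (by exact_mod_cast Nat.lt_succ_of_le hn) (Nat.succ_ne_zero n)

theorem cast_add_one_pow_ne_one {n : ℕ} (hn : 1 ≤ n) : ((n : ℂ) + 1) ^ (n + 1) ≠ 1 := by
  exact_mod_cast (one_lt_cast_add_one_pow hn).ne'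

/-- Fails for `n = 0`. Leading coefficients are shown to be nonzero by evaluation at this point. -/
theorem one_mem_S {n : ℕ} (hn : 1 ≤ n) : (1 : ℂ) ∈ S n := by
  rw [mem_S_iff, one_pow]
  exact (cast_add_one_pow_ne_one hn).symm

/-! ### Coordinates on `X` -/

/-- The coordinate function `z_i` on `X`. -/
def coordZ (n : ℕ) (i : Fin (n + 1)) : OX n :=
  Hol.of (fun p => p.1.1 i) (fun p => p.1 i) (fun p _ => analyticAt_coord n i p) fun _ => rfl

/-- Evaluation of holomorphic functions at a point. -/
def Hol.evalAt {E : Type*} [NormedAddCommGroup E] [NormedSpace ℂ E] {U : Opens E} (x : U) :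
    Hol U →ₐ[ℂ] ℂ where
  toFun f := f.val x
  map_one' := rfl
  map_mul' _ _ := rfl
  map_zero' := rfl
  map_add' _ _ := rfl
  commutes' _ := rfl

theorem Hol.ext_evalAt {E : Type*} [NormedAddCommGroup E] [NormedSpace ℂ E] {U : Opens E}
    {f g : Hol U} (h : ∀ x, Hol.evalAt x f = Hol.evalAt x g) : f = g := Hol.ext h

theorem evalAt_coordZ (n : ℕ) (i : Fin (n + 1)) (p : X n) :
    Hol.evalAt p (coordZ n i) = p.1.1 i := rfl

theorem evalAt_coordA (n : ℕ) (a : S n) : Hol.evalAt a (coordA n) = a := rfl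

theorem pd_coordZ (n : ℕ) (v : (Fin (n + 1) → ℂ) × ℂ) (i : Fin (n + 1)) :
    Hol.pd v (coordZ n i) = algebraMap ℂ (OX n) (v.1 i) := by
  ext p
  rw [Hol.pd_eq v (coordZ n i) ((ContinuousLinearMap.proj (R := ℂ)
    (φ := fun _ : Fin (n + 1) => ℂ) i).comp (ContinuousLinearMap.fst ℂ _ ℂ)) (fun _ => rfl),
    ContinuousLinearMap.fderiv]
  rfl

theorem ddz_coordZ_self (n : ℕ) (i : Fin (n + 1)) : ddz n i (coordZ n i) = 1 := by
  rw [ddz, pd_coordZ]; simp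

theorem ddz_coordZ_of_ne (n : ℕ) {i j : Fin (n + 1)} (h : j ≠ i) : ddz n i (coordZ n j) = 0 := by
  rw [ddz, pd_coordZ]; simp [h]

theorem dda_coordZ (n : ℕ) (i : Fin (n + 1)) : dda n (coordZ n i) = 0 := by
  rw [dda, pd_coordZ]; simp

theorem ddaS_coordA (n : ℕ) : ddaS n (coordA n) = 1 := by
  ext a
  rw [ddaS, Hol.pd_eq 1 (coordA n) (ContinuousLinearMap.id ℂ ℂ) (fun _ => rfl),
    ContinuousLinearMap.fderiv]
  rfl

theorem derivation_prod_eq_zero {R A ι : Type*} [CommRing R] [CommRing A] [Algebra R A]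
    (δ : Derivation R A A) (s : Finset ι) (f : ι → A) (h : ∀ i ∈ s, δ (f i) = 0) :
    δ (∏ i ∈ s, f i) = 0 := by
  classical
  induction s using Finset.induction_on with
  | empty => simp
  | insert j s hj ih =>
    rw [Finset.prod_insert hj, Derivation.leibniz, h j (Finset.mem_insert_self _ _),
      ih fun i hi => h i (Finset.mem_insert_of_mem hi)]
    simp

theorem monomialX_eq_prod (n : ℕ) (p : Fin (n + 1) → ℕ) :
    monomialX n p = ∏ i, coordZ n i ^ p i := by
  refine Hol.ext_evalAt fun x => ?_
  simp only [map_prod, map_pow, evalAt_coordZ]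
  rfl

theorem monomialX_mul (n : ℕ) (p q : Fin (n + 1) → ℕ) :
    monomialX n p * monomialX n q = monomialX n (p + q) := by
  simp only [monomialX_eq_prod, ← Finset.prod_mul_distrib, Pi.add_apply, pow_add]

theorem monomialX_single (n : ℕ) (i : Fin (n + 1)) (k : ℕ) :
    monomialX n (Pi.single i k) = coordZ n i ^ k := by
  rw [monomialX_eq_prod, Finset.prod_eq_single i]
  · simp
  · intro j _ hj
    simp [hj]
  · simp

theorem F_eq (n : ℕ) : F n = ∑ i, coordZ n i ^ (n + 1) - pull n (coordA n) * monomialX n 1 := by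
  refine Hol.ext_evalAt fun x => ?_
  simp only [monomialX_eq_prod, map_sub, map_sum, map_mul, map_prod, map_pow, evalAt_coordZ,
    Pi.one_apply, pow_one]
  exact eval_dworkPoly n x.1.2 x.1.1

/-- For `p i = 0` the truncated `p i - 1` is harmless, because its coefficient vanishes. -/
theorem ddz_monomialX (n : ℕ) (i : Fin (n + 1)) (p : Fin (n + 1) → ℕ) :
    ddz n i (monomialX n p) = (p i : ℂ) • monomialX n (Function.update p i (p i - 1)) := by
  have h0 : ddz n i (∏ j ∈ Finset.univ.erase i, coordZ n j ^ p j) = 0 := by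
    refine derivation_prod_eq_zero _ _ _ fun j hj => ?_
    rw [Derivation.leibniz_pow, ddz_coordZ_of_ne n (Finset.ne_of_mem_erase hj)]
    simp
  have h1 : ∏ j ∈ Finset.univ.erase i, coordZ n j ^ (Function.update p i (p i - 1)) j =
      ∏ j ∈ Finset.univ.erase i, coordZ n j ^ p j :=
    Finset.prod_congr rfl fun j hj => by
      rw [Function.update_of_ne (Finset.ne_of_mem_erase hj)]
  rw [monomialX_eq_prod, monomialX_eq_prod, ← Finset.mul_prod_erase _ _ (Finset.mem_univ i),
    ← Finset.mul_prod_erase _ _ (Finset.mem_univ i), h1, Derivation.leibniz, h0,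
    Derivation.leibniz_pow, ddz_coordZ_self, Function.update_self, Algebra.smul_def (R := ℂ)]
  simp only [smul_eq_mul, nsmul_eq_mul, map_natCast]
  ring

theorem dda_monomialX (n : ℕ) (p : Fin (n + 1) → ℕ) : dda n (monomialX n p) = 0 := by
  rw [monomialX_eq_prod]
  refine derivation_prod_eq_zero _ _ _ fun j _ => ?_
  rw [Derivation.leibniz_pow, dda_coordZ]
  simp

theorem dda_F (n : ℕ) : dda n (F n) = -monomialX n 1 := by
  have : dda n (∑ i, coordZ n i ^ (n + 1)) = 0 := by
    rw [map_sum]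
    refine Finset.sum_eq_zero fun i _ => ?_
    rw [Derivation.leibniz_pow, dda_coordZ]
    simp
  rw [F_eq, map_sub, this, Derivation.leibniz, dda_monomialX, dda_pull, ddaS_coordA]
  simp

theorem ddz_F (n : ℕ) (i : Fin (n + 1)) :
    ddz n i (F n) = ((n : ℂ) + 1) • monomialX n (Pi.single i n) -
      pull n (coordA n) * monomialX n (Function.update 1 i 0) := by
  have : ddz n i (∑ j, coordZ n j ^ (n + 1)) = ((n : ℂ) + 1) • coordZ n i ^ n := by
    rw [map_sum, Finset.sum_eq_single i]
    · rw [Derivation.leibniz_pow, ddz_coordZ_self, Algebra.smul_def (R := ℂ)]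
      simp
    · intro j _ hj
      rw [Derivation.leibniz_pow, ddz_coordZ_of_ne n hj]
      simp
    · simp
  rw [F_eq, map_sub, this, Derivation.leibniz, ddz_pull, ddz_monomialX, monomialX_single]
  simp

/-! ### Classes of top forms in the Gauss-Manin system -/

/-- The form `g Ω`. -/
def topForm (n : ℕ) : OX n →ₗ[ℂ] Omega n (n + 1) where
  toFun g := ⟨Forms.mk fun I => if I = Finset.univ then g else 0, fun I hI => if_neg (by
    rintro rfl
    simp at hI)⟩
  map_add' g h := Subtype.ext <| Forms.ext fun I => by
    by_cases hI : I = Finset.univ <;> simp [hI]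
  map_smul' c g := Subtype.ext <| Forms.ext fun I => by
    by_cases hI : I = Finset.univ <;> simp [hI]

theorem coeff_topForm (n : ℕ) (g : OX n) (I : Finset (Fin (n + 1))) :
    (topForm n g).1.coeff I = if I = Finset.univ then g else 0 := rfl

/-- The class of `g Ω ∂_t^k` in the Gauss-Manin system. -/
def gmClass (n k : ℕ) : OX n →ₗ[ℂ] GaussManin n :=
  (boundaries n).mkQ ∘ₗ ((Finsupp.lsingle k : Forms n →ₗ[ℂ] FormsD n).restrict
    fun _ => single_mem k) ∘ₗ topForm n

theorem gmClass_apply (n k : ℕ) (g : OX n) : gmClass n k g = (boundaries n).mkQ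
    ⟨Finsupp.single k (topForm n g).1, single_mem k (topForm n g).2⟩ := rfl

theorem brieskornToGM_geomSection_monomialForm (n : ℕ) (m : Fin (n + 1) → ℕ) :
    brieskornToGM n (geomSection n (monomialForm n m)) = gmClass n 0 (monomialX n m) := rfl

theorem coeffwise_topForm (n : ℕ) (δ : Derivation ℂ (OX n) (OX n)) (g : OX n) :
    coeffwise n δ (topForm n g).1 = (topForm n (δ g)).1 := by
  refine Forms.ext fun I => ?_
  change δ ((topForm n g).1.coeff I) = _
  rw [coeff_topForm, coeff_topForm]
  split_ifs <;> simp

theorem mulForm_topForm (n : ℕ) (h g : OX n) :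
    mulForm n h (topForm n g).1 = (topForm n (h * g)).1 := by
  refine Forms.ext fun I => ?_
  change h * ((topForm n g).1.coeff I) = _
  rw [coeff_topForm, coeff_topForm]
  split_ifs <;> simp

theorem conn_gmClass (n k : ℕ) (g : OX n) :
    conn n (gmClass n k g) = gmClass n k (dda n g) - gmClass n (k + 1) (dda n (F n) * g) := by
  simp only [gmClass_apply, ← map_sub]
  refine congrArg (boundaries n).mkQ (Subtype.ext ?_)
  change preConn n (Finsupp.single k (topForm n g).1) =
    Finsupp.single k _ - Finsupp.single (k + 1) _
  simp only [preConn, LinearMap.sub_apply, LinearMap.comp_apply, extendD_single, shiftD_single,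
    coeffwise_topForm, mulForm_topForm]

theorem mulGM_gmClass (n k : ℕ) (c : OS n) (g : OX n) :
    mulGM n c (gmClass n k g) = gmClass n k (pull n c * g) := by
  simp only [gmClass_apply]
  refine congrArg (boundaries n).mkQ (Subtype.ext ?_)
  change preMul n c (Finsupp.single k (topForm n g).1) = Finsupp.single k _
  simp only [preMul, extendD_single, mulForm_topForm]

/-- The contraction of `g Ω` with `∂/∂z_i`. -/
def contractForm (n : ℕ) (i : Fin (n + 1)) (g : OX n) : Forms n :=
  Forms.mk fun I => if I = Finset.univ.erase i then
    (-1) ^ ((Finset.univ : Finset (Fin (n + 1))).filter (· < i)).card * g else 0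

theorem contractForm_mem (n : ℕ) (i : Fin (n + 1)) (g : OX n) : contractForm n i g ∈ Omega n n := by
  intro I hI
  refine if_neg ?_
  rintro rfl
  simp [Finset.card_erase_of_mem] at hI

theorem coeffwise_contractForm (n : ℕ) (i : Fin (n + 1)) (δ : Derivation ℂ (OX n) (OX n))
    (g : OX n) : coeffwise n δ (contractForm n i g) = contractForm n i (δ g) := by
  refine Forms.ext fun I => ?_
  by_cases h : I = Finset.univ.erase i
  · rcases neg_one_pow_eq_or (OX n)
      ((Finset.univ : Finset (Fin (n + 1))).filter (· < i)).card with h' | h' <;>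
      simp [coeffwise, contractForm, h, h']
  · simp [coeffwise, contractForm, h]

/-- The sign in `contractForm` is the one that `dzWedge` produces on the full index set, so the two
cancel. -/
theorem dzWedge_contractForm_self (n : ℕ) (i : Fin (n + 1)) (g : OX n) :
    dzWedge n i (contractForm n i g) = (topForm n g).1 := by
  refine Forms.ext fun J => ?_
  rw [coeff_topForm]
  by_cases hJ : J = Finset.univ
  · subst hJ
    simp [dzWedge, contractForm, ← mul_assoc, ← mul_pow]
  · rw [if_neg hJ]
    by_cases hi : i ∈ J
    · have : J.erase i ≠ Finset.univ.erase i := by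
        intro h
        apply hJ
        rw [← Finset.insert_erase hi, h, Finset.insert_erase (Finset.mem_univ i)]
      simp [dzWedge, contractForm, this]
    · simp [dzWedge, hi]

theorem dzWedge_contractForm_of_ne (n : ℕ) {i j : Fin (n + 1)} (h : j ≠ i) (g : OX n) :
    dzWedge n j (contractForm n i g) = 0 := by
  refine Forms.ext fun J => ?_
  have : J.erase j ≠ Finset.univ.erase i := by
    intro h'
    have : j ∈ J.erase j := by rw [h']; simp [h]
    simp at this
  simp [dzWedge, contractForm, this]

/-- The class of `d(g ι_i Ω)` is `∂_t` times the class of `dF ∧ g ι_i Ω`. -/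
theorem gmClass_ddz (n k : ℕ) (i : Fin (n + 1)) (g : OX n) :
    gmClass n k (ddz n i g) = gmClass n (k + 1) (ddz n i (F n) * g) := by
  rw [← sub_eq_zero]
  simp only [gmClass_apply, ← map_sub]
  rw [Submodule.mkQ_apply, Submodule.Quotient.mk_eq_zero]
  refine ⟨Finsupp.single k (contractForm n i g), single_mem k (contractForm_mem n i g), ?_⟩
  change twistedD n _ = Finsupp.single k (topForm n (ddz n i g)).1 -
    Finsupp.single (k + 1) (topForm n (ddz n i (F n) * g)).1
  have h1 : extD n (contractForm n i g) = (topForm n (ddz n i g)).1 := by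
    rw [extD_apply, Finset.sum_eq_single i]
    · rw [coeffwise_contractForm, dzWedge_contractForm_self]
    · intro j _ hj
      rw [coeffwise_contractForm, dzWedge_contractForm_of_ne n hj]
    · simp
  have h2 : dWedge n (F n) (contractForm n i g) = (topForm n (ddz n i (F n) * g)).1 := by
    rw [dWedge_apply, Finset.sum_eq_single i]
    · rw [dzWedge_contractForm_self]
      exact mulForm_topForm n _ g
    · intro j _ hj
      rw [dzWedge_contractForm_of_ne n hj]
      exact smul_zero (ddz n j (F n))
    · simp
  simp only [twistedD, LinearMap.sub_apply, LinearMap.comp_apply, extendD_single, shiftD_single,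
    h1, h2]

/-! ### Calculus in the ring of differential operators -/

/-- Functions as differential operators, as an algebra homomorphism. -/
def DiffOp.fnHom (n : ℕ) : OS n →ₐ[ℂ] DiffOp n where
  toFun := DiffOp.fn
  map_one' := by
    have := RingQuot.mkAlgHom_rel ℂ (DiffRel.const (n := n) 1)
    simpa [DiffOp.fn] using this
  map_mul' f g := by
    have := RingQuot.mkAlgHom_rel ℂ (DiffRel.mul f g)
    simpa [DiffOp.fn] using this
  map_zero' := by
    have := RingQuot.mkAlgHom_rel ℂ (DiffRel.const (n := n) 0)
    simpa [DiffOp.fn] using this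
  map_add' f g := by
    have := RingQuot.mkAlgHom_rel ℂ (DiffRel.add f g)
    simpa [DiffOp.fn] using this
  commutes' c := by
    have := RingQuot.mkAlgHom_rel ℂ (DiffRel.const (n := n) c)
    simpa [DiffOp.fn] using this

theorem DiffOp.fnHom_apply {n : ℕ} (f : OS n) : DiffOp.fnHom n f = DiffOp.fn f := rfl

theorem DiffOp.del_mul_fn {n : ℕ} (f : OS n) :
    DiffOp.del n * DiffOp.fn f = DiffOp.fn f * DiffOp.del n + DiffOp.fn (ddaS n f) := by
  have := RingQuot.mkAlgHom_rel ℂ (DiffRel.leibniz f)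
  simpa [DiffOp.fn, DiffOp.del] using this

theorem DiffOp.theta_mul_fn {n : ℕ} (f : OS n) :
    DiffOp.theta n * DiffOp.fn f =
      DiffOp.fn f * DiffOp.theta n + DiffOp.fn (coordA n * ddaS n f) := by
  rw [DiffOp.theta, mul_assoc, DiffOp.del_mul_fn, mul_add]
  simp only [← DiffOp.fnHom_apply, ← mul_assoc, ← map_mul]
  rw [mul_comm (coordA n) f]

theorem coordA_mul_ddaS_pow (n k : ℕ) :
    coordA n * ddaS n (coordA n ^ k) = (k : ℂ) • coordA n ^ k := by
  rw [Derivation.leibniz_pow, ddaS_coordA, Algebra.smul_def (R := ℂ)]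
  cases k with
  | zero => simp
  | succ k =>
    simp only [smul_eq_mul, nsmul_eq_mul, map_natCast, Nat.add_sub_cancel]
    ring

/-- Used with `x = θ`, `y = θ + k` and `u = c a^k`. -/
theorem aeval_mul_of_semiconj {A : Type*} [Ring A] [Algebra ℂ A] {x y u : A}
    (h : x * u = u * y) (Q : Polynomial ℂ) :
    Polynomial.aeval x Q * u = u * Polynomial.aeval y Q := by
  have hp : ∀ k : ℕ, x ^ k * u = u * y ^ k := by
    intro k
    induction k with
    | zero => simp
    | succ k ih => rw [pow_succ, mul_assoc, h, ← mul_assoc, ih, mul_assoc, ← pow_succ]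
  induction Q using Polynomial.induction_on' with
  | add P Q hP hQ => rw [map_add, map_add, add_mul, mul_add, hP, hQ]
  | monomial k c =>
    rw [Polynomial.aeval_monomial, Polynomial.aeval_monomial, mul_assoc, hp, ← mul_assoc,
      Algebra.commutes, mul_assoc]

/-- `Q(θ) a^k = a^k Q(θ + k)`. -/
theorem DiffOp.aeval_theta_mul_fn (n k : ℕ) (c : ℂ) (Q : Polynomial ℂ) :
    Polynomial.aeval (DiffOp.theta n) Q * DiffOp.fn (c • coordA n ^ k) =
      DiffOp.fn (c • coordA n ^ k) * Polynomial.aeval (DiffOp.theta n)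
        (Q.comp (Polynomial.X + Polynomial.C (k : ℂ))) := by
  rw [Polynomial.aeval_comp]
  refine aeval_mul_of_semiconj ?_ Q
  rw [DiffOp.theta_mul_fn, Derivation.map_smul, mul_smul_comm, coordA_mul_ddaS_pow, map_add,
    Polynomial.aeval_X, Polynomial.aeval_C, mul_add, ← Algebra.commutes, ← Algebra.smul_def]
  simp only [← DiffOp.fnHom_apply, map_smul]
  rw [smul_comm c]

theorem DiffOp.aeval_theta_mul_fn_pow (n k : ℕ) (Q : Polynomial ℂ) :
    Polynomial.aeval (DiffOp.theta n) Q * DiffOp.fn (coordA n ^ k) =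
      DiffOp.fn (coordA n ^ k) * Polynomial.aeval (DiffOp.theta n)
        (Q.comp (Polynomial.X + Polynomial.C (k : ℂ))) := by
  simpa using DiffOp.aeval_theta_mul_fn n k 1 Q

/-! ### Relations between monomial classes -/

theorem gmAction_fn (n : ℕ) (f : OS n) : gmAction n (DiffOp.fn f) = mulGM n f := by
  rw [gmAction, DiffOp.fn, RingQuot.liftAlgHom_mkAlgHom_apply, FreeAlgebra.lift_ι_apply]
  rfl

theorem gmAction_del (n : ℕ) : gmAction n (DiffOp.del n) = conn n := by
  rw [gmAction, DiffOp.del, RingQuot.liftAlgHom_mkAlgHom_apply, FreeAlgebra.lift_ι_apply]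
  rfl

/-- The class of `z^p Ω ∂_t^k` in the Gauss-Manin system. -/
def gmMonomial (n k : ℕ) (p : Fin (n + 1) → ℕ) : GaussManin n := gmClass n k (monomialX n p)

/-- The monomial does not involve `a`, and `-∂F/∂a = ∏ z_i`. -/
theorem gmAction_del_gmMonomial (n k : ℕ) (p : Fin (n + 1) → ℕ) :
    gmAction n (DiffOp.del n) (gmMonomial n k p) = gmMonomial n (k + 1) (p + 1) := by
  rw [gmAction_del, gmMonomial, conn_gmClass, dda_monomialX, dda_F, neg_mul, monomialX_mul,
    map_zero, map_neg, zero_sub, neg_neg, add_comm 1 p, gmMonomial]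

theorem gmAction_theta_gmMonomial (n k : ℕ) (p : Fin (n + 1) → ℕ) :
    gmAction n (DiffOp.theta n) (gmMonomial n k p) =
      gmAction n (DiffOp.fn (coordA n)) (gmMonomial n (k + 1) (p + 1)) := by
  rw [DiffOp.theta, map_mul, Module.End.mul_apply, gmAction_del_gmMonomial]

/-- This is `gmClass_ddz` for `g = z^p`, with `∂F/∂z_i` written out; the next two lemmas are its
cases `p i = 0` and `p + e_i`. -/
theorem smul_gmMonomial_update (n k : ℕ) (p : Fin (n + 1) → ℕ) (i : Fin (n + 1)) :
    (p i : ℂ) • gmMonomial n k (Function.update p i (p i - 1)) =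
      ((n : ℂ) + 1) • gmMonomial n (k + 1) (p + Pi.single i n) -
        gmAction n (DiffOp.fn (coordA n))
        (gmMonomial n (k + 1) (p + Function.update (1 : Fin (n + 1) → ℕ) i 0)) := by
  have h := gmClass_ddz n k i (monomialX n p)
  rw [ddz_monomialX, ddz_F, map_smul, sub_mul, smul_mul_assoc, mul_assoc, monomialX_mul,
    monomialX_mul, map_sub, map_smul, add_comm _ p, add_comm _ p] at h
  rw [gmAction_fn, gmMonomial, h, gmMonomial, gmMonomial, mulGM_gmClass]

/-- The exponent `n` of `z_i` drops to `0` while all others grow by one, and the power of `∂_t`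
stays. This step lowers the order of the annihilating operator. -/
theorem smul_gmMonomial_add_single (n k : ℕ) (p : Fin (n + 1) → ℕ) (i : Fin (n + 1))
    (hp : p i = 0) :
    ((n : ℂ) + 1) • gmMonomial n (k + 1) (p + Pi.single i n) =
      gmAction n (DiffOp.fn (coordA n))
        (gmMonomial n (k + 1) (p + Function.update (1 : Fin (n + 1) → ℕ) i 0)) := by
  have h := smul_gmMonomial_update n k p i
  rw [hp, Nat.cast_zero, zero_smul] at h
  exact (sub_eq_zero.1 h.symm)

/-- In the relation for `p + e_i`, the term with coefficient `a` has exponent `p + 𝟙` and is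
therefore `θ [z^p ∂_t^k]`. -/
theorem gmAction_theta_add_gmMonomial (n k : ℕ) (p : Fin (n + 1) → ℕ) (i : Fin (n + 1)) :
    gmAction n (DiffOp.theta n) (gmMonomial n k p) + ((p i : ℂ) + 1) • gmMonomial n k p =
      ((n : ℂ) + 1) • gmMonomial n (k + 1) (p + Pi.single i (n + 1)) := by
  have h := smul_gmMonomial_update n k (p + Pi.single i 1) i
  have h1 : Function.update (p + Pi.single i 1) i
      ((p + Pi.single i 1 : Fin (n + 1) → ℕ) i - 1) = p := by
    funext j
    by_cases hj : j = i
    · subst hj; simp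
    · simp [hj]
  have h2 : p + Pi.single i 1 + Pi.single i n = p + Pi.single i (n + 1) := by
    rw [add_assoc, ← Pi.single_add, add_comm 1 n]
  have h3 : p + Pi.single i 1 + Function.update (1 : Fin (n + 1) → ℕ) i 0 = p + 1 := by
    funext j
    by_cases hj : j = i
    · subst hj; simp
    · simp [hj]
  rw [h1, h2, h3, ← gmAction_theta_gmMonomial] at h
  have h4 : (((p + Pi.single i 1 : Fin (n + 1) → ℕ) i : ℕ) : ℂ) = (p i : ℂ) + 1 := by simp
  rw [h4] at h
  rw [h]
  abel

/-- The factor of index `i` sees only the `i`-th exponent, which the other factors leave equal to `m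
i`. -/
theorem gmAction_prod_theta_add (n : ℕ) (m : Fin (n + 1) → ℕ) (J : Finset (Fin (n + 1))) :
    gmAction n (Polynomial.aeval (DiffOp.theta n)
        (∏ i ∈ J, (Polynomial.X + Polynomial.C ((m i : ℂ) + 1)))) (gmMonomial n 0 m) =
      ((n : ℂ) + 1) ^ J.card •
        gmMonomial n J.card (fun j => if j ∈ J then m j + (n + 1) else m j) := by
  induction J using Finset.induction_on with
  | empty => simp
  | insert i J hi ih =>
    rw [Finset.prod_insert hi, map_mul, map_mul, Module.End.mul_apply, ih, map_smul,
      Finset.card_insert_of_notMem hi, pow_succ, mul_smul]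
    congr 1
    have h := gmAction_theta_add_gmMonomial n J.card
      (fun j => if j ∈ J then m j + (n + 1) else m j) i
    simp only [hi, if_false] at h
    have h1 : (fun j => if j ∈ J then m j + (n + 1) else m j) + Pi.single i (n + 1) =
        fun j => if j ∈ insert i J then m j + (n + 1) else m j := by
      funext j
      by_cases hj : j = i
      · subst hj; simp [hi]
      · simp [hj]
    rw [h1] at h
    rw [← h, map_add, Polynomial.aeval_X, Polynomial.aeval_C, map_add, AlgHom.commutes,
      LinearMap.add_apply, Module.algebraMap_end_apply]

/-! ### Annihilation of monomial classes -/

/-- The exponents reached from `z^m` after `k` steps, where the `i`-th exponent, `i ∈ I`, drops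
from `n` to `0` instead of increasing to `n + 1`. -/
def stepExponent (n : ℕ) (m : Fin (n + 1) → ℕ) (I : Finset (Fin (n + 1))) (k : ℕ) :
    Fin (n + 1) → ℕ :=
  fun j => if j ∈ I ∧ n < m j + k then m j + k - (n + 1) else m j + k

/-- The steps at which an exponent drops. -/
def dropSteps (n : ℕ) (m : Fin (n + 1) → ℕ) (I : Finset (Fin (n + 1))) : Finset ℕ :=
  I.image fun i => n - m i

theorem stepExponent_succ_of_ne {n : ℕ} {m : Fin (n + 1) → ℕ} {I : Finset (Fin (n + 1))} {k : ℕ}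
    {j : Fin (n + 1)} (h : j ∈ I → m j + k ≠ n) :
    stepExponent n m I (k + 1) j = stepExponent n m I k j + 1 := by
  unfold stepExponent
  by_cases hj : j ∈ I
  · have := h hj
    simp only [hj, true_and]
    split_ifs <;> omega
  · simp [hj, add_assoc]

/-- Each step contributes one factor `a`. An ordinary step `k` applies `θ - k` and raises the power
of `∂_t`; a drop step applies no operator and costs a constant `n + 1` instead. -/
theorem gmAction_prod_theta_sub (n : ℕ) (m : Fin (n + 1) → ℕ) (I : Finset (Fin (n + 1)))
    (hinj : Set.InjOn m I) (hlt : ∀ i ∈ I, m i < n) (k : ℕ) (hk : k ≤ n + 1) :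
    ((n : ℂ) + 1) ^ (Finset.range k ∩ dropSteps n m I).card •
      gmAction n (Polynomial.aeval (DiffOp.theta n)
        (∏ l ∈ Finset.range k \ dropSteps n m I, (Polynomial.X - Polynomial.C (l : ℂ))))
        (gmMonomial n 0 m) =
      gmAction n (DiffOp.fn (coordA n ^ k))
        (gmMonomial n (Finset.range k \ dropSteps n m I).card (stepExponent n m I k)) := by
  set D := dropSteps n m I with hD
  induction k with
  | zero =>
    have : stepExponent n m I 0 = m := by
      funext j
      unfold stepExponent
      by_cases hj : j ∈ I
      · have := hlt j hj
        simp only [hj, true_and, add_zero]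
        rw [if_neg (by omega)]
      · simp [hj]
    have h1 : DiffOp.fn (1 : OS n) = 1 := map_one (DiffOp.fnHom n)
    simp [this, h1]
  | succ k ih =>
    specialize ih (Nat.le_of_succ_le hk)
    have hfn : ∀ x, gmAction n (DiffOp.fn (coordA n ^ (k + 1))) x =
        gmAction n (DiffOp.fn (coordA n ^ k)) (gmAction n (DiffOp.fn (coordA n)) x) := by
      intro x
      rw [← Module.End.mul_apply, ← map_mul]
      simp only [← DiffOp.fnHom_apply]
      rw [← map_mul, pow_succ]
    by_cases hkD : k ∈ D
    · rw [Finset.range_add_one, Finset.insert_inter_of_mem hkD, Finset.insert_sdiff_of_mem _ hkD,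
        Finset.card_insert_of_notMem (by simp), pow_succ', mul_smul, ih, hfn, ← map_smul]
      congr 1
      obtain ⟨i, hiI, hik⟩ := Finset.mem_image.1 hkD
      have hmi := hlt i hiI
      -- The trade needs a positive power of `∂_t`. Step `0` is never a drop, since `m i < n` on
      -- `I`, so at least one `∂_t` is present.
      have h0 : 0 ∈ Finset.range k \ D := by
        rw [Finset.mem_sdiff, Finset.mem_range]
        refine ⟨by omega, fun h => ?_⟩
        obtain ⟨j, hjI, hj⟩ := Finset.mem_image.1 h
        have := hlt j hjI
        omega
      obtain ⟨t, ht⟩ : ∃ t, (Finset.range k \ D).card = t + 1 :=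
        ⟨_, (Nat.succ_pred_eq_of_pos (Finset.card_pos.2 ⟨0, h0⟩)).symm⟩
      have h := smul_gmMonomial_add_single n t (Function.update (stepExponent n m I k) i 0) i
        (Function.update_self _ _ _)
      have hi1 : stepExponent n m I k i = n := by
        unfold stepExponent
        rw [if_neg (by omega)]
        omega
      have hi2 : stepExponent n m I (k + 1) i = 0 := by
        unfold stepExponent
        rw [if_pos ⟨hiI, by omega⟩]
        omega
      have e1 : Function.update (stepExponent n m I k) i 0 + Pi.single i n =
          stepExponent n m I k := by
        funext j
        by_cases hj : j = i
        · subst hj; simp [hi1]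
        · simp [hj]
      have e2 : Function.update (stepExponent n m I k) i 0 + Function.update (1 : Fin (n + 1) → ℕ) i 0 =
          stepExponent n m I (k + 1) := by
        funext j
        by_cases hj : j = i
        · subst hj; simp [hi2]
        · rw [stepExponent_succ_of_ne]
          · simp [hj]
          -- Injectivity of `m` on `I`: no second index of `I` reaches `n` at the same step.
          · intro hjI hjk
            exact hj (hinj hjI hiI (by omega))
      rw [e1, e2] at h
      rw [ht, h]
    · rw [Finset.range_add_one, Finset.insert_inter_of_notMem hkD,
        Finset.insert_sdiff_of_notMem _ hkD, Finset.prod_insert (by simp),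
        Finset.card_insert_of_notMem (by simp), map_mul, map_mul, Module.End.mul_apply, ← map_smul,
        ih, ← Module.End.mul_apply, ← map_mul, DiffOp.aeval_theta_mul_fn_pow]
      have e : stepExponent n m I (k + 1) = stepExponent n m I k + 1 := by
        funext j
        refine stepExponent_succ_of_ne fun hjI hjk => hkD ?_
        exact Finset.mem_image.2 ⟨j, hjI, by omega⟩
      -- Moving `θ - k` to the right of `a^k` leaves `θ`.
      have hX : (Polynomial.X - Polynomial.C (k : ℂ)).comp
          (Polynomial.X + Polynomial.C (k : ℂ)) = Polynomial.X := by simp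
      rw [hX, Polynomial.aeval_X, map_mul, Module.End.mul_apply, gmAction_theta_gmMonomial, e, hfn]

/-- The right factor of `L_m` that remains after division by the factors `θ - (n - m_i)`,
`i ∈ I`, on the left. -/
def rightFactor (n : ℕ) (m : Fin (n + 1) → ℕ) (I : Finset (Fin (n + 1))) : DiffOp n :=
  Polynomial.aeval (DiffOp.theta n)
      (∏ l ∈ Finset.range (n + 1) \ dropSteps n m I, (Polynomial.X - Polynomial.C (l : ℂ))) -
    DiffOp.fn ((((n : ℂ) + 1) ^ (n + 1))⁻¹ • coordA n ^ (n + 1)) *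
      Polynomial.aeval (DiffOp.theta n)
        (∏ i ∈ Iᶜ, (Polynomial.X + Polynomial.C ((m i : ℂ) + 1)))

theorem card_dropSteps {n : ℕ} {m : Fin (n + 1) → ℕ} {I : Finset (Fin (n + 1))}
    (hinj : Set.InjOn m I) (hlt : ∀ i ∈ I, m i < n) : (dropSteps n m I).card = I.card := by
  refine Finset.card_image_of_injOn fun i hi j hj h => hinj hi hj ?_
  have h1 := hlt i hi
  have h2 := hlt j hj
  change n - m i = n - m j at h
  omega

theorem dropSteps_subset (n : ℕ) (m : Fin (n + 1) → ℕ) (I : Finset (Fin (n + 1))) :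
    dropSteps n m I ⊆ Finset.range (n + 1) := by
  intro l hl
  obtain ⟨j, -, hj⟩ := Finset.mem_image.1 hl
  rw [Finset.mem_range]
  omega

theorem card_range_sdiff_dropSteps {n : ℕ} {m : Fin (n + 1) → ℕ} {I : Finset (Fin (n + 1))}
    (hinj : Set.InjOn m I) (hlt : ∀ i ∈ I, m i < n) :
    (Finset.range (n + 1) \ dropSteps n m I).card = n + 1 - I.card := by
  rw [Finset.card_sdiff_of_subset (dropSteps_subset n m I), card_dropSteps hinj hlt,
    Finset.card_range]

theorem card_compl_fin {n : ℕ} (I : Finset (Fin (n + 1))) : (Iᶜ).card = n + 1 - I.card := by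
  rw [Finset.card_compl, Fintype.card_fin]

/-- Both terms reach the same monomial with the same power `n + 1 - |I|` of `∂_t`. The `|I|`
constants lost in drop steps and the `n + 1 - |I|` gained from the factors `θ + m_i + 1` together
cancel `(n+1)^(n+1)`. -/
theorem gmAction_rightFactor (n : ℕ) (m : Fin (n + 1) → ℕ) (I : Finset (Fin (n + 1)))
    (hinj : Set.InjOn m I) (hlt : ∀ i ∈ I, m i < n) :
    gmAction n (rightFactor n m I) (gmMonomial n 0 m) = 0 := by
  have hn0 : (n : ℂ) + 1 ≠ 0 := Nat.cast_add_one_ne_zero n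
  have hcard : I.card ≤ n + 1 := by simpa using Finset.card_le_univ I
  have hA := gmAction_prod_theta_sub n m I hinj hlt (n + 1) le_rfl
  rw [Finset.inter_eq_right.2 (dropSteps_subset n m I), card_dropSteps hinj hlt,
    card_range_sdiff_dropSteps hinj hlt] at hA
  have hB := gmAction_prod_theta_add n m Iᶜ
  rw [card_compl_fin] at hB
  have he : (fun j => if j ∈ Iᶜ then m j + (n + 1) else m j) = stepExponent n m I (n + 1) := by
    funext j
    unfold stepExponent
    by_cases hj : j ∈ I
    · rw [if_neg (by simpa using hj), if_pos ⟨hj, by omega⟩]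
      omega
    · simp [hj]
  rw [he] at hB
  have hs : ((n : ℂ) + 1) ^ I.card * ((((n : ℂ) + 1) ^ (n + 1))⁻¹ *
      ((n : ℂ) + 1) ^ (n + 1 - I.card)) = 1 := by
    rw [mul_left_comm, ← pow_add, Nat.add_sub_cancel' hcard, inv_mul_cancel₀ (pow_ne_zero _ hn0)]
  have hfn : DiffOp.fn ((((n : ℂ) + 1) ^ (n + 1))⁻¹ • coordA n ^ (n + 1)) =
      (((n : ℂ) + 1) ^ (n + 1))⁻¹ • DiffOp.fn (coordA n ^ (n + 1)) :=
    map_smul (DiffOp.fnHom n) _ _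
  have key : ((n : ℂ) + 1) ^ I.card •
      gmAction n (rightFactor n m I) (gmMonomial n 0 m) = 0 := by
    rw [rightFactor, map_sub, LinearMap.sub_apply, smul_sub, hA, map_mul, Module.End.mul_apply, hB,
      hfn, map_smul (gmAction n), LinearMap.smul_apply, map_smul, smul_smul, smul_smul, mul_assoc, hs,
      one_smul, sub_self]
  exact (smul_eq_zero.1 key).resolve_left (pow_ne_zero _ hn0)

theorem picardFuchs_eq_rightFactor (n : ℕ) (m : Fin (n + 1) → ℕ) :
    picardFuchs n m = rightFactor n m ∅ := by
  have h : ∏ i ∈ Finset.range (n + 1), (Polynomial.X + Polynomial.C ((i : ℂ) - n)) =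
      ∏ l ∈ Finset.range (n + 1), (Polynomial.X - Polynomial.C (l : ℂ)) := by
    rw [← Finset.prod_range_reflect]
    refine Finset.prod_congr rfl fun l hl => ?_
    have hl' : l ≤ n := Nat.lt_succ_iff.1 (Finset.mem_range.1 hl)
    rw [Nat.add_sub_cancel, Nat.cast_sub hl', sub_eq_add_neg _ (Polynomial.C _),
      ← Polynomial.C_neg]
    congr 2
    ring
  rw [picardFuchs, rightFactor, h]
  simp [dropSteps]

/-- The operator depends only on the values of `m` on `I` and on its complement, with multiplicity.
Hence one `R` serves all permutations of `m`. -/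
theorem rightFactor_comp_perm (n : ℕ) (m : Fin (n + 1) → ℕ) (I : Finset (Fin (n + 1)))
    (σ : Equiv.Perm (Fin (n + 1))) :
    rightFactor n (m ∘ σ) (I.map σ.symm.toEmbedding) = rightFactor n m I := by
  have h1 : dropSteps n (m ∘ σ) (I.map σ.symm.toEmbedding) = dropSteps n m I := by
    rw [dropSteps, dropSteps, Finset.map_eq_image, Finset.image_image]
    refine Finset.image_congr fun i _ => ?_
    simp
  have h2 : ∏ i ∈ (I.map σ.symm.toEmbedding)ᶜ,
      (Polynomial.X + Polynomial.C (((m ∘ σ) i : ℂ) + 1)) =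
      ∏ i ∈ Iᶜ, (Polynomial.X + Polynomial.C ((m i : ℂ) + 1)) := by
    refine Finset.prod_equiv σ (fun i => ?_) fun i _ => rfl
    rw [Finset.mem_compl, Finset.mem_compl, Finset.mem_map_equiv, Equiv.symm_symm]
  rw [rightFactor, rightFactor, h1, h2]

/-! ### Orders of differential operators -/

/-- `L = ∑_{k ≤ r} c_k ∂_a^k` with `c_r = f`. -/
def DiffOp.HasSymbol {n : ℕ} (L : DiffOp n) (r : ℕ) (f : OS n) : Prop :=
  ∃ c : ℕ → OS n, c r = f ∧
    L = ∑ k ∈ Finset.range (r + 1), DiffOp.fn (c k) * DiffOp.del n ^ k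

theorem DiffOp.HasSymbol.hasOrder {n r : ℕ} {L : DiffOp n} {f : OS n} (h : L.HasSymbol r f)
    (hf : f ≠ 0) : L.HasOrder r := by
  obtain ⟨c, hc, hL⟩ := h
  exact ⟨c, hc ▸ hf, hL⟩

theorem DiffOp.HasSymbol.add {n r : ℕ} {L M : DiffOp n} {f g : OS n} (hL : L.HasSymbol r f)
    (hM : M.HasSymbol r g) : (L + M).HasSymbol r (f + g) := by
  obtain ⟨c, rfl, rfl⟩ := hL
  obtain ⟨d, rfl, rfl⟩ := hM
  refine ⟨c + d, rfl, ?_⟩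
  rw [← Finset.sum_add_distrib]
  refine Finset.sum_congr rfl fun k _ => ?_
  simp only [← DiffOp.fnHom_apply, Pi.add_apply, map_add, add_mul]

theorem DiffOp.HasSymbol.fn_mul {n r : ℕ} {L : DiffOp n} {f : OS n} (hL : L.HasSymbol r f)
    (g : OS n) : (DiffOp.fn g * L).HasSymbol r (g * f) := by
  obtain ⟨c, rfl, rfl⟩ := hL
  refine ⟨fun k => g * c k, rfl, ?_⟩
  rw [Finset.mul_sum]
  refine Finset.sum_congr rfl fun k _ => ?_
  simp only [← DiffOp.fnHom_apply, map_mul, mul_assoc]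

/-- Padding with a zero coefficient lets operators of different orders be added with
`HasSymbol.add`. -/
theorem DiffOp.HasSymbol.succ {n r : ℕ} {L : DiffOp n} {f : OS n} (hL : L.HasSymbol r f) :
    L.HasSymbol (r + 1) 0 := by
  obtain ⟨c, rfl, rfl⟩ := hL
  refine ⟨Function.update c (r + 1) 0, Function.update_self _ _ _, ?_⟩
  rw [Finset.sum_range_succ _ (r + 1), Function.update_self, ← DiffOp.fnHom_apply, map_zero,
    zero_mul, add_zero]
  refine Finset.sum_congr rfl fun k hk => ?_
  rw [Function.update_of_ne (Finset.mem_range.1 hk).ne]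

theorem DiffOp.HasSymbol.del_mul {n r : ℕ} {L : DiffOp n} {f : OS n} (hL : L.HasSymbol r f) :
    (DiffOp.del n * L).HasSymbol (r + 1) f := by
  obtain ⟨c, rfl, rfl⟩ := hL
  have h1 : (∑ k ∈ Finset.range (r + 1), DiffOp.fn (ddaS n (c k)) * DiffOp.del n ^ k).HasSymbol
      (r + 1) 0 := DiffOp.HasSymbol.succ ⟨fun k => ddaS n (c k), rfl, rfl⟩
  have h2 : (∑ k ∈ Finset.range (r + 1), DiffOp.fn (c k) * DiffOp.del n ^ (k + 1)).HasSymbol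
      (r + 1) (c r) := by
    refine ⟨fun k => k.casesOn 0 c, rfl, ?_⟩
    have h0 : DiffOp.fn (0 : OS n) = 0 := map_zero (DiffOp.fnHom n)
    rw [Finset.sum_range_succ' _ (r + 1)]
    change _ = _ + DiffOp.fn (0 : OS n) * _
    rw [h0, zero_mul, add_zero]
  have h := h2.add h1
  rw [add_zero, ← Finset.sum_add_distrib] at h
  convert h using 1
  rw [Finset.mul_sum]
  refine Finset.sum_congr rfl fun k _ => ?_
  rw [← mul_assoc, DiffOp.del_mul_fn, add_mul, mul_assoc, ← pow_succ']

theorem DiffOp.hasSymbol_one (n : ℕ) : (1 : DiffOp n).HasSymbol 0 1 :=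
  ⟨1, rfl, by simp [← DiffOp.fnHom_apply]⟩

/-- `∏ (θ_a + b_i)` has leading coefficient `a^r`, where `r` is the number of factors. -/
theorem DiffOp.hasSymbol_prod {ι : Type*} (n : ℕ) (s : Finset ι) (b : ι → ℂ) :
    (Polynomial.aeval (DiffOp.theta n)
      (∏ i ∈ s, (Polynomial.X + Polynomial.C (b i)))).HasSymbol s.card (coordA n ^ s.card) := by
  classical
  induction s using Finset.induction_on with
  | empty => simpa using DiffOp.hasSymbol_one n
  | insert i s hi ih =>
    rw [Finset.prod_insert hi, Finset.card_insert_of_notMem hi, map_mul, map_add,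
      Polynomial.aeval_X, Polynomial.aeval_C, add_mul, ← (DiffOp.fnHom n).commutes,
      DiffOp.fnHom_apply, pow_succ']
    nth_rewrite 1 [DiffOp.theta]
    rw [mul_assoc]
    simpa using (ih.del_mul.fn_mul (coordA n)).add (ih.fn_mul (algebraMap ℂ (OS n) (b i))).succ

/-- Both terms have order `r = n + 1 - |I|`, with joint leading coefficient `a^r (1 -
a^(n+1)/(n+1)^(n+1))`, which is nonzero at `a = 1`. -/
theorem rightFactor_hasOrder {n : ℕ} (hn : 1 ≤ n) {m : Fin (n + 1) → ℕ}
    {I : Finset (Fin (n + 1))} (hinj : Set.InjOn m I) (hlt : ∀ i ∈ I, m i < n) :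
    (rightFactor n m I).HasOrder (n + 1 - I.card) := by
  have hA := DiffOp.hasSymbol_prod n (Finset.range (n + 1) \ dropSteps n m I)
    fun l => -(l : ℂ)
  rw [card_range_sdiff_dropSteps hinj hlt] at hA
  have hB := (DiffOp.hasSymbol_prod n Iᶜ fun i => (m i : ℂ) + 1).fn_mul
    (-((((n : ℂ) + 1) ^ (n + 1))⁻¹ • coordA n ^ (n + 1)))
  rw [card_compl_fin] at hB
  have h := hA.add hB
  have hne : coordA n ^ (n + 1 - I.card) + -((((n : ℂ) + 1) ^ (n + 1))⁻¹ • coordA n ^ (n + 1)) *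
      coordA n ^ (n + 1 - I.card) ≠ 0 := by
    intro h0
    have h1 := congrArg (Hol.evalAt (⟨1, one_mem_S hn⟩ : S n)) h0
    simp only [map_add, map_mul, map_neg, map_smul, map_pow, evalAt_coordA, map_zero, one_pow,
      mul_one, smul_eq_mul] at h1
    refine cast_add_one_pow_ne_one hn ?_
    rw [← inv_inj, inv_one]
    linear_combination -h1
  have h2 := h.hasOrder hne
  have hsub : ∀ (f : OS n) (x y : DiffOp n), x - DiffOp.fn f * y = x + DiffOp.fn (-f) * y := by
    intro f x y
    rw [sub_eq_iff_eq_add, add_assoc, ← add_mul, ← DiffOp.fnHom_apply, ← DiffOp.fnHom_apply,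
      ← map_add, neg_add_cancel, map_zero, zero_mul, add_zero]
  rw [rightFactor, hsub]
  simpa only [Polynomial.C_neg, ← sub_eq_add_neg] using h2

/-! ### Taylor coefficients and left factors -/

/-- The action of differential operators on functions on `S`. -/
def funAction (n : ℕ) : DiffOp n →ₐ[ℂ] Module.End ℂ (OS n) :=
  RingQuot.liftAlgHom ℂ ⟨FreeAlgebra.lift ℂ
    (fun o => o.elim (ddaS n : OS n →ₗ[ℂ] OS n) (LinearMap.mulLeft ℂ)), by
    intro x y hxy
    cases hxy with
    | add f g =>
      simp only [FreeAlgebra.lift_ι_apply, map_add, Option.elim]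
      exact LinearMap.ext fun h => add_mul f g h
    | mul f g =>
      simp only [FreeAlgebra.lift_ι_apply, map_mul, Option.elim]
      exact LinearMap.ext fun h => mul_assoc f g h
    | const c =>
      simp only [FreeAlgebra.lift_ι_apply, AlgHom.commutes, Option.elim]
      exact LinearMap.ext fun h => (Algebra.smul_def c h).symm
    | leibniz f =>
      simp only [FreeAlgebra.lift_ι_apply, map_mul, map_add, Option.elim]
      refine LinearMap.ext fun h => ?_
      change ddaS n (f * h) = f * ddaS n h + ddaS n f * h
      rw [Derivation.leibniz, smul_eq_mul, smul_eq_mul, mul_comm h]⟩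

theorem funAction_fn (n : ℕ) (f g : OS n) : funAction n (DiffOp.fn f) g = f * g := by
  rw [funAction, DiffOp.fn, RingQuot.liftAlgHom_mkAlgHom_apply, FreeAlgebra.lift_ι_apply]
  rfl

theorem funAction_del (n : ℕ) (g : OS n) : funAction n (DiffOp.del n) g = ddaS n g := by
  rw [funAction, DiffOp.del, RingQuot.liftAlgHom_mkAlgHom_apply, FreeAlgebra.lift_ι_apply]
  rfl

theorem funAction_theta (n : ℕ) (g : OS n) :
    funAction n (DiffOp.theta n) g = coordA n * ddaS n g := by
  rw [DiffOp.theta, map_mul, Module.End.mul_apply, funAction_fn, funAction_del]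

/-- The coefficient of `a^t` in the Taylor series at `0 ∈ S`. -/
def taylorCoeff (n t : ℕ) : OS n →ₗ[ℂ] ℂ :=
  (t.factorial : ℂ)⁻¹ • ((Hol.evalAt (⟨0, zero_mem_S n⟩ : S n)).toLinearMap ∘ₗ
    (ddaS n : OS n →ₗ[ℂ] OS n) ^ t)

theorem taylorCoeff_apply (n t : ℕ) (f : OS n) : taylorCoeff n t f =
    (t.factorial : ℂ)⁻¹ * Hol.evalAt (⟨0, zero_mem_S n⟩ : S n)
      (((ddaS n : OS n →ₗ[ℂ] OS n) ^ t) f) := rfl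

theorem ddaS_pow_coordA_mul (n t : ℕ) (g : OS n) :
    ((ddaS n : OS n →ₗ[ℂ] OS n) ^ (t + 1)) (coordA n * g) =
      coordA n * ((ddaS n : OS n →ₗ[ℂ] OS n) ^ (t + 1)) g +
        ((t : OS n) + 1) * ((ddaS n : OS n →ₗ[ℂ] OS n) ^ t) g := by
  induction t with
  | zero => simp [ddaS_coordA, add_comm]
  | succ t ih =>
    rw [pow_succ', Module.End.mul_apply, ih, map_add]
    simp only [Derivation.coeFn_coe, Derivation.leibniz, ddaS_coordA, smul_eq_mul, map_add,
      Derivation.map_natCast, Derivation.map_one_eq_zero]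
    rw [Module.End.mul_apply, pow_succ' _ t, Module.End.mul_apply]
    simp only [Derivation.coeFn_coe]
    push_cast
    ring

theorem taylorCoeff_zero_coordA_mul (n : ℕ) (g : OS n) : taylorCoeff n 0 (coordA n * g) = 0 := by
  simp [taylorCoeff_apply, evalAt_coordA]

theorem taylorCoeff_succ_coordA_mul (n t : ℕ) (g : OS n) :
    taylorCoeff n (t + 1) (coordA n * g) = taylorCoeff n t g := by
  have h : ((t : ℂ) + 1) ≠ 0 := Nat.cast_add_one_ne_zero t
  have h' : (t.factorial : ℂ) ≠ 0 := Nat.cast_ne_zero.2 t.factorial_ne_zero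
  rw [taylorCoeff_apply, taylorCoeff_apply, ddaS_pow_coordA_mul, map_add, map_mul, map_mul,
    evalAt_coordA, map_add, map_natCast, map_one, Nat.factorial_succ]
  push_cast
  field_simp
  ring

theorem taylorCoeff_ddaS (n t : ℕ) (g : OS n) :
    taylorCoeff n t (ddaS n g) = ((t : ℂ) + 1) * taylorCoeff n (t + 1) g := by
  have h : ((t : ℂ) + 1) ≠ 0 := Nat.cast_add_one_ne_zero t
  have h' : (t.factorial : ℂ) ≠ 0 := Nat.cast_ne_zero.2 t.factorial_ne_zero
  rw [taylorCoeff_apply, taylorCoeff_apply, pow_succ, Module.End.mul_apply, Nat.factorial_succ]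
  push_cast
  field_simp

theorem taylorCoeff_coordA_pow_mul (n s j : ℕ) (g : OS n) :
    taylorCoeff n (s + j) (coordA n ^ s * g) = taylorCoeff n j g := by
  induction s with
  | zero => simp
  | succ s ih =>
    rw [pow_succ', mul_assoc, Nat.add_right_comm, taylorCoeff_succ_coordA_mul, ih]

theorem taylorCoeff_coordA_pow_mul_of_lt (n : ℕ) {t s : ℕ} (h : t < s) (g : OS n) :
    taylorCoeff n t (coordA n ^ s * g) = 0 := by
  obtain ⟨k, rfl⟩ := Nat.exists_eq_add_of_lt h
  have : coordA n ^ (t + k + 1) * g = coordA n ^ t * (coordA n * (coordA n ^ k * g)) := by ring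
  rw [this]
  have := taylorCoeff_coordA_pow_mul n t 0 (coordA n * (coordA n ^ k * g))
  rw [add_zero] at this
  rw [this, taylorCoeff_zero_coordA_mul]

theorem taylorCoeff_theta (n t : ℕ) (g : OS n) :
    taylorCoeff n t (funAction n (DiffOp.theta n) g) = (t : ℂ) * taylorCoeff n t g := by
  rw [funAction_theta]
  cases t with
  | zero => simp [taylorCoeff_zero_coordA_mul]
  | succ t => rw [taylorCoeff_succ_coordA_mul, taylorCoeff_ddaS]; push_cast; rfl

theorem taylorCoeff_aeval_theta (n t : ℕ) (Q : Polynomial ℂ) (g : OS n) :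
    taylorCoeff n t (funAction n (Polynomial.aeval (DiffOp.theta n) Q) g) =
      Q.eval (t : ℂ) * taylorCoeff n t g := by
  induction Q using Polynomial.induction_on generalizing g with
  | C c => simp [Module.algebraMap_end_apply]
  | add P Q hP hQ => simp [hP, hQ, add_mul]
  | monomial k c ih =>
    rw [pow_succ, ← mul_assoc, map_mul, map_mul, Module.End.mul_apply, ih, Polynomial.aeval_X,
      taylorCoeff_theta]
    simp
    ring

theorem aeval_theta_coordA_pow (n s : ℕ) (Q : Polynomial ℂ) :
    funAction n (Polynomial.aeval (DiffOp.theta n) Q) (coordA n ^ s) =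
      Q.eval (s : ℂ) • coordA n ^ s := by
  induction Q using Polynomial.induction_on with
  | C c => simp [Module.algebraMap_end_apply]
  | add P Q hP hQ => simp [hP, hQ, add_smul]
  | monomial k c ih =>
    rw [pow_succ, ← mul_assoc, map_mul, map_mul, Module.End.mul_apply, Polynomial.aeval_X,
      funAction_theta, coordA_mul_ddaS_pow, map_smul, ih, smul_smul, Polynomial.eval_mul_X,
      mul_comm]

theorem funAction_del_pow_coordA_pow (n k s : ℕ) :
    funAction n (DiffOp.del n ^ k) (coordA n ^ s) =
      (s.descFactorial k : ℂ) • coordA n ^ (s - k) := by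
  induction k with
  | zero => simp
  | succ k ih =>
    rw [pow_succ', map_mul, Module.End.mul_apply, ih, map_smul, funAction_del,
      Derivation.leibniz_pow, ddaS_coordA, Nat.descFactorial_succ, smul_eq_mul, mul_one,
      ← Nat.cast_smul_eq_nsmul ℂ, smul_smul, Nat.sub_sub]
    push_cast
    rw [mul_comm]

/-- Every differential operator is a combination of operators `f ∂_a^k`. -/
theorem DiffOp.mem_span (n : ℕ) (L : DiffOp n) :
    L ∈ Submodule.span ℂ (Set.range fun q : OS n × ℕ => DiffOp.fn q.1 * DiffOp.del n ^ q.2) := by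
  set M := Submodule.span ℂ
    (Set.range fun q : OS n × ℕ => DiffOp.fn q.1 * DiffOp.del n ^ q.2) with hM
  have hgen : ∀ (f : OS n) (k : ℕ), DiffOp.fn f * DiffOp.del n ^ k ∈ M := fun f k =>
    Submodule.subset_span ⟨(f, k), rfl⟩
  have hclosed : ∀ x : DiffOp n, (∀ (f : OS n) (k : ℕ), x * (DiffOp.fn f * DiffOp.del n ^ k) ∈ M) →
      ∀ y ∈ M, x * y ∈ M := by
    intro x hx y hy
    induction hy using Submodule.span_induction with
    | mem y hy =>
      obtain ⟨q, rfl⟩ := hy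
      exact hx q.1 q.2
    | zero => rw [mul_zero]; exact M.zero_mem
    | add y z _ _ h h' => rw [mul_add]; exact M.add_mem h h'
    | smul c y _ h => rw [mul_smul_comm]; exact M.smul_mem c h
  -- Stability of the span under left multiplication passes to products in the free algebra; the
  -- claim follows by applying it to `1`.
  have key : ∀ x : FreeAlgebra ℂ (Option (OS n)), ∀ y ∈ M,
      RingQuot.mkAlgHom ℂ (DiffRel n) x * y ∈ M := by
    intro x
    induction x using FreeAlgebra.induction with
    | grade0 c =>
      intro y hy
      rw [AlgHom.commutes, ← Algebra.smul_def]
      exact M.smul_mem c hy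
    | grade1 o =>
      refine hclosed _ fun f k => ?_
      cases o with
      | none =>
        change DiffOp.del n * (DiffOp.fn f * DiffOp.del n ^ k) ∈ M
        rw [← mul_assoc, DiffOp.del_mul_fn, add_mul, mul_assoc, ← pow_succ']
        exact M.add_mem (hgen _ _) (hgen _ _)
      | some g =>
        change DiffOp.fn g * (DiffOp.fn f * DiffOp.del n ^ k) ∈ M
        rw [← mul_assoc, ← DiffOp.fnHom_apply, ← DiffOp.fnHom_apply, ← map_mul]
        exact hgen _ _
    | mul x y hx hy =>
      intro z hz
      rw [map_mul, mul_assoc]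
      exact hx _ (hy _ hz)
    | add x y hx hy =>
      intro z hz
      rw [map_add, add_mul]
      exact M.add_mem (hx _ hz) (hy _ hz)
  obtain ⟨x, rfl⟩ := RingQuot.mkAlgHom_surjective ℂ (DiffRel n) L
  have h1 : (1 : DiffOp n) ∈ M := by
    simpa [← DiffOp.fnHom_apply] using hgen 1 0
  simpa using key x 1 h1

/-- The part of weight `j` of a differential operator is `a^j p(θ_a)` for a polynomial `p`. -/
theorem exists_taylorCoeff_eq_eval (n j : ℕ) (L : DiffOp n) : ∃ p : Polynomial ℂ, ∀ s : ℕ,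
    taylorCoeff n (s + j) (funAction n L (coordA n ^ s)) = p.eval (s : ℂ) := by
  induction DiffOp.mem_span n L using Submodule.span_induction with
  | mem L hL =>
    obtain ⟨⟨f, k⟩, rfl⟩ := hL
    -- `f ∂_a^k a^s` is `s(s-1)⋯(s-k+1) f a^(s-k)`, whose coefficient of `a^(s+j)` involves only the
    -- coefficient of `a^(j+k)` in `f`. For `s < k` the falling factorial vanishes.
    refine ⟨descPochhammer ℂ k * Polynomial.C (taylorCoeff n (j + k) f), fun s => ?_⟩
    rw [Polynomial.eval_mul, Polynomial.eval_C, descPochhammer_eval_eq_descFactorial, map_mul,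
      Module.End.mul_apply, funAction_del_pow_coordA_pow, map_smul, map_smul, funAction_fn,
      smul_eq_mul]
    rcases lt_or_ge s k with h | h
    · rw [Nat.descFactorial_of_lt h]
      simp
    · rw [mul_comm f, show s + j = (s - k) + (j + k) by omega, taylorCoeff_coordA_pow_mul]
  | zero => exact ⟨0, fun s => by simp⟩
  | add L M _ _ hL hM =>
    obtain ⟨p, hp⟩ := hL
    obtain ⟨q, hq⟩ := hM
    exact ⟨p + q, fun s => by simp [hp, hq]⟩
  | smul c L _ hL =>
    obtain ⟨p, hp⟩ := hL
    exact ⟨c • p, fun s => by simp [hp]⟩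

theorem polynomial_eq_of_eval_natCast {p q : Polynomial ℂ}
    (h : ∀ s : ℕ, p.eval (s : ℂ) = q.eval (s : ℂ)) : p = q :=
  Polynomial.eq_of_infinite_eval_eq p q <|
    (Set.infinite_range_of_injective (Nat.cast_injective (R := ℂ))).mono <| by
      rintro _ ⟨s, rfl⟩
      exact h s

theorem taylorCoeff_coordA_pow_self (n s : ℕ) : taylorCoeff n s (coordA n ^ s) = 1 := by
  have := taylorCoeff_coordA_pow_mul n s 0 1
  rw [mul_one, add_zero] at this
  rw [this, taylorCoeff_apply]
  simp

theorem taylorCoeff_coordA_pow_of_lt (n : ℕ) {s t : ℕ} (h : s < t) :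
    taylorCoeff n t (coordA n ^ s) = 0 := by
  obtain ⟨k, rfl⟩ := Nat.exists_eq_add_of_lt h
  have := taylorCoeff_coordA_pow_mul n s (k + 1) 1
  rw [mul_one] at this
  rw [add_assoc, this, taylorCoeff_apply, pow_succ, Module.End.mul_apply]
  simp

/-- A left factor `Q(θ_a)` of `A(θ_a) - c a^N B(θ_a)` divides `A`, and `Q(x + N)` divides `B`. -/
theorem dvd_of_eq_aeval_theta_mul (n : ℕ) {N : ℕ} (hN : 0 < N) {c : ℂ} (hc : c ≠ 0)
    {A B Q : Polynomial ℂ} {R : DiffOp n}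
    (h : Polynomial.aeval (DiffOp.theta n) A -
      DiffOp.fn (c • coordA n ^ N) * Polynomial.aeval (DiffOp.theta n) B =
      Polynomial.aeval (DiffOp.theta n) Q * R) :
    Q ∣ A ∧ Q.comp (Polynomial.X + Polynomial.C (N : ℂ)) ∣ B := by
  have hact : ∀ s : ℕ, funAction n (Polynomial.aeval (DiffOp.theta n) Q * R) (coordA n ^ s) =
      A.eval (s : ℂ) • coordA n ^ s - (c * B.eval (s : ℂ)) • coordA n ^ (s + N) := by
    intro s
    rw [← h, map_sub, LinearMap.sub_apply, map_mul, Module.End.mul_apply, aeval_theta_coordA_pow,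
      aeval_theta_coordA_pow, map_smul, funAction_fn, smul_mul_assoc, smul_smul, ← pow_add,
      add_comm N s, mul_comm c]
  have hlow : ∀ s : ℕ, taylorCoeff n s (coordA n ^ (s + N)) = 0 := fun s => by
    simpa using taylorCoeff_coordA_pow_mul_of_lt n (Nat.lt_add_of_pos_right hN) 1
  constructor
  · obtain ⟨p, hp⟩ := exists_taylorCoeff_eq_eval n 0 R
    -- The coefficient of `a^s` in the image of `a^s` gives `Q(s) p(s) = A(s)`.
    refine ⟨p, polynomial_eq_of_eval_natCast fun s => ?_⟩
    have h1 := congrArg (taylorCoeff n s) (hact s)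
    rw [map_mul, Module.End.mul_apply, taylorCoeff_aeval_theta, map_sub, map_smul, map_smul,
      taylorCoeff_coordA_pow_self, hlow, smul_zero, sub_zero, smul_eq_mul, mul_one] at h1
    rw [← h1, Polynomial.eval_mul, ← hp s, add_zero]
  · obtain ⟨p, hp⟩ := exists_taylorCoeff_eq_eval n N R
    -- The coefficient of `a^(s+N)` gives `Q(s+N) p(s) = -c B(s)`.
    refine ⟨Polynomial.C (-c⁻¹) * p, polynomial_eq_of_eval_natCast fun s => ?_⟩
    have h1 := congrArg (taylorCoeff n (s + N)) (hact s)
    rw [map_mul, Module.End.mul_apply, taylorCoeff_aeval_theta, map_sub, map_smul, map_smul,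
      taylorCoeff_coordA_pow_self, taylorCoeff_coordA_pow_of_lt n (Nat.lt_add_of_pos_right hN),
      smul_zero, zero_sub, smul_eq_mul, mul_one, hp] at h1
    simp only [Polynomial.eval_mul, Polynomial.eval_comp, Polynomial.eval_add, Polynomial.eval_X,
      Polynomial.eval_C]
    push_cast at h1
    field_simp
    linear_combination h1

/-! ### The greatest left factor -/

/-- The product of the `x - (n - m_i)`, `i ∈ I`. -/
def leftFactor (n : ℕ) (m : Fin (n + 1) → ℕ) (I : Finset (Fin (n + 1))) : Polynomial ℂ :=
  ∏ l ∈ dropSteps n m I, (Polynomial.X - Polynomial.C (l : ℂ))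

theorem leftFactor_mul_prod (n : ℕ) (m : Fin (n + 1) → ℕ) (I : Finset (Fin (n + 1))) :
    leftFactor n m I *
      ∏ l ∈ Finset.range (n + 1) \ dropSteps n m I, (Polynomial.X - Polynomial.C (l : ℂ)) =
      ∏ l ∈ Finset.range (n + 1), (Polynomial.X - Polynomial.C (l : ℂ)) := by
  rw [leftFactor, mul_comm, Finset.prod_sdiff (dropSteps_subset n m I)]

theorem leftFactor_comp {n : ℕ} {m : Fin (n + 1) → ℕ} {I : Finset (Fin (n + 1))}
    (hinj : Set.InjOn m I) (hlt : ∀ i ∈ I, m i < n) :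
    (leftFactor n m I).comp (Polynomial.X + Polynomial.C ((n + 1 : ℕ) : ℂ)) =
      ∏ i ∈ I, (Polynomial.X + Polynomial.C ((m i : ℂ) + 1)) := by
  rw [leftFactor, dropSteps, Finset.prod_image, Polynomial.prod_comp]
  · refine Finset.prod_congr rfl fun i hi => ?_
    rw [Polynomial.sub_comp, Polynomial.X_comp, Polynomial.C_comp, Nat.cast_sub (hlt i hi).le,
      add_sub_assoc, ← Polynomial.C_sub]
    congr 2
    push_cast
    ring
  · intro i hi j hj h
    have h1 := hlt i hi
    have h2 := hlt j hj
    change n - m i = n - m j at h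
    exact hinj hi hj (by omega)

/-- Passing `a^(n+1)` turns `leftFactor` into exactly the factors `θ + m_i + 1`, `i ∈ I`, missing
from `rightFactor`. -/
theorem picardFuchs_eq_mul_rightFactor {n : ℕ} {m : Fin (n + 1) → ℕ}
    {I : Finset (Fin (n + 1))} (hinj : Set.InjOn m I) (hlt : ∀ i ∈ I, m i < n) :
    picardFuchs n m =
      Polynomial.aeval (DiffOp.theta n) (leftFactor n m I) * rightFactor n m I := by
  have hB : (∏ i ∈ I, (Polynomial.X + Polynomial.C ((m i : ℂ) + 1))) *
      ∏ i ∈ Iᶜ, (Polynomial.X + Polynomial.C ((m i : ℂ) + 1)) =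
      ∏ i, (Polynomial.X + Polynomial.C ((m i : ℂ) + 1)) := Finset.prod_mul_prod_compl I _
  rw [picardFuchs_eq_rightFactor, rightFactor, rightFactor, mul_sub, ← map_mul,
    leftFactor_mul_prod, ← mul_assoc, DiffOp.aeval_theta_mul_fn, leftFactor_comp hinj hlt,
    mul_assoc, ← map_mul, hB]
  simp [dropSteps]

theorem natDegree_leftFactor {n : ℕ} {m : Fin (n + 1) → ℕ} {I : Finset (Fin (n + 1))}
    (hinj : Set.InjOn m I) (hlt : ∀ i ∈ I, m i < n) : (leftFactor n m I).natDegree = I.card := by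
  rw [leftFactor, Polynomial.natDegree_finsetProd_X_sub_C_eq_card, card_dropSteps hinj hlt]

theorem dvd_leftFactor {n : ℕ} {m : Fin (n + 1) → ℕ} {I : Finset (Fin (n + 1))}
    (hinj : Set.InjOn m I) (hlt : ∀ i, m i < n) (himg : I.image m = Finset.univ.image m)
    {Q : Polynomial ℂ} {R : DiffOp n}
    (h : picardFuchs n m = Polynomial.aeval (DiffOp.theta n) Q * R) : Q ∣ leftFactor n m I := by
  have hc : (((n : ℂ) + 1) ^ (n + 1))⁻¹ ≠ 0 :=
    inv_ne_zero (pow_ne_zero _ (Nat.cast_add_one_ne_zero n))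
  rw [picardFuchs_eq_rightFactor, rightFactor] at h
  obtain ⟨h1, h2⟩ := dvd_of_eq_aeval_theta_mul n n.succ_pos hc h
  have hD : dropSteps n m ∅ = ∅ := rfl
  rw [hD, Finset.sdiff_empty, ← leftFactor_mul_prod n m I] at h1
  rw [Finset.compl_empty, ← Finset.prod_mul_prod_compl I, ← leftFactor_comp hinj fun i _ => hlt i]
    at h2
  have hcomp : ∀ P : Polynomial ℂ, (P.comp (Polynomial.X + Polynomial.C ((n + 1 : ℕ) : ℂ))).comp
      (Polynomial.X - Polynomial.C ((n + 1 : ℕ) : ℂ)) = P := by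
    intro P
    rw [Polynomial.comp_assoc]
    simp
  -- Undoing the shift by `n + 1` makes both divisibilities statements about `Q` itself, with
  -- `leftFactor` a common factor of the two multiples.
  have h3 := map_dvd (Polynomial.compRingHom (Polynomial.X - Polynomial.C ((n + 1 : ℕ) : ℂ))) h2
  simp only [map_mul, Polynomial.coe_compRingHom_apply] at h3
  rw [hcomp, hcomp, Polynomial.prod_comp] at h3
  -- The cofactors share no root: those of the second are numbers `n - m i`, and by `himg` every
  -- such number is already a drop step, hence removed from the first. Bézout then gives `Q ∣
  -- leftFactor`.
  have hcop : IsCoprime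
      (∏ l ∈ Finset.range (n + 1) \ dropSteps n m I, (Polynomial.X - Polynomial.C (l : ℂ)))
      (∏ i ∈ Iᶜ, (Polynomial.X + Polynomial.C ((m i : ℂ) + 1)).comp
        (Polynomial.X - Polynomial.C ((n + 1 : ℕ) : ℂ))) := by
    refine IsCoprime.prod_left fun l hl => IsCoprime.prod_right fun i _ => ?_
    have hi : (Polynomial.X + Polynomial.C ((m i : ℂ) + 1)).comp
        (Polynomial.X - Polynomial.C ((n + 1 : ℕ) : ℂ)) =
        Polynomial.X - Polynomial.C ((n - m i : ℕ) : ℂ) := by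
      rw [Polynomial.add_comp, Polynomial.X_comp, Polynomial.C_comp, Nat.cast_sub (hlt i).le,
        sub_add, ← Polynomial.C_sub]
      congr 2
      push_cast
      ring
    rw [hi]
    refine Polynomial.isCoprime_X_sub_C_of_isUnit_sub (sub_ne_zero.2 fun hli => ?_).isUnit
    rw [Nat.cast_inj] at hli
    have hmem : m i ∈ I.image m := himg ▸ Finset.mem_image_of_mem m (Finset.mem_univ i)
    obtain ⟨j, hj, hji⟩ := Finset.mem_image.1 hmem
    refine (Finset.mem_sdiff.1 hl).2 (Finset.mem_image.2 ⟨j, hj, ?_⟩)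
    rw [hji, hli]
  obtain ⟨u, v, huv⟩ := hcop
  have := dvd_add (h1.mul_left u) (h3.mul_left v)
  convert this using 1
  linear_combination -(leftFactor n m I) * huv

end Dwork

end

theorem mainTheorem5 (n : ℕ) (hn : 1 ≤ n) :
    (Dwork.S n : Set ℂ) = {a : ℂ | a ^ (n + 1) ≠ ((n : ℂ) + 1) ^ (n + 1)} ∧
    ∀ m : Fin (n + 1) → ℕ,
      (Dwork.picardFuchs n m).HasOrder (n + 1) ∧
      Dwork.gmAction n (Dwork.picardFuchs n m)
        (Dwork.brieskornToGM n (Dwork.geomSection n (Dwork.monomialForm n m))) = 0 ∧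
      (∀ σ : Equiv.Perm (Fin (n + 1)),
        Dwork.picardFuchs n (m ∘ σ) = Dwork.picardFuchs n m) ∧
      ((∀ i, m i ≤ n - 1) →
        ∃ (P : Polynomial ℂ) (R : Dwork.DiffOp n),
          Dwork.picardFuchs n m = Polynomial.aeval (Dwork.DiffOp.theta n) P * R ∧
          (∀ (Q : Polynomial ℂ) (R' : Dwork.DiffOp n),
            Dwork.picardFuchs n m = Polynomial.aeval (Dwork.DiffOp.theta n) Q * R' → Q ∣ P) ∧
          P.natDegree = (Finset.univ.image fun i => m i + 1).card ∧
          R.HasOrder (n + 1 - (Finset.univ.image fun i => m i + 1).card) ∧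
          ∀ σ : Equiv.Perm (Fin (n + 1)),
            Dwork.gmAction n R
              (Dwork.brieskornToGM n (Dwork.geomSection n (Dwork.monomialForm n (m ∘ σ)))) = 0) := by
  refine ⟨Set.ext fun a => Dwork.mem_S_iff n a, fun m => ⟨?_, ?_, fun σ => ?_, fun hm => ?_⟩⟩
  · rw [Dwork.picardFuchs_eq_rightFactor]
    simpa using Dwork.rightFactor_hasOrder hn (m := m) (I := ∅) (by simp) (by simp)
  · rw [Dwork.picardFuchs_eq_rightFactor, Dwork.brieskornToGM_geomSection_monomialForm]
    exact Dwork.gmAction_rightFactor n m ∅ (by simp) (by simp)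
  · rw [Dwork.picardFuchs_eq_rightFactor, Dwork.picardFuchs_eq_rightFactor,
      ← Dwork.rightFactor_comp_perm n m ∅ σ, Finset.map_empty]
  · have hlt : ∀ i, m i < n := fun i => by
      have := hm i
      omega
    -- `I` contains exactly one index for each value of `m`, so its cardinality is `c`.
    obtain ⟨I, -, hinj, himg⟩ := Finset.exists_subset_injOn_image_eq_of_surjOn
      (Set.univ : Set (Fin (n + 1))) (Finset.univ.image m) (f := m) (by
        intro v hv
        simpa using hv)
    have hcard : (Finset.univ.image fun i => m i + 1).card = I.card := by
      rw [← Finset.card_image_of_injOn hinj, himg,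
        ← Finset.card_image_of_injective (Finset.univ.image m) (add_left_injective 1), Finset.image_image]
      rfl
    refine ⟨Dwork.leftFactor n m I, Dwork.rightFactor n m I,
      Dwork.picardFuchs_eq_mul_rightFactor hinj fun i _ => hlt i,
      fun Q R' h => Dwork.dvd_leftFactor hinj hlt himg h, ?_, ?_, fun σ => ?_⟩
    · rw [hcard, Dwork.natDegree_leftFactor hinj fun i _ => hlt i]
    · rw [hcard]
      exact Dwork.rightFactor_hasOrder hn hinj fun i _ => hlt i
    · rw [← Dwork.rightFactor_comp_perm n m I σ, Dwork.brieskornToGM_geomSection_monomialForm]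
      refine Dwork.gmAction_rightFactor n (m ∘ σ) _ ?_ fun i _ => hlt _
      intro i hi j hj hij
      rw [Finset.mem_coe, Finset.mem_map_equiv, Equiv.symm_symm] at hi hj
      exact σ.injective (hinj hi hj hij)
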